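/- Let $(E,\mathcal{E})$ be a measurable space. Let $\mathcal{B}$ be the Banach space of bounded measurable functions $f:E\to\mathbb{C}$ with the norm $\|f\|=\sup_E|f|$, and let $\mathcal{X}$ be the space of bounded measurable functions $\chi:E\times E\to\mathbb{C}$ with $\|\chi\|=\sup_{E\times E}|\chi|$. A bounded positive kernel is a function $Q:E\times\mathcal{E}\to\mathbb{R}_+$ such that $Q(\cdot,A)$ is measurable for every $A\in\mathcal{E}$, $Q(x,\cdot)$ is a measure for every $x\in E$, and $\sup_{x}Q(x,E)<+\infty$. It acts on $\mathcal{B}$ by $Qf(x)=\int_E f(y)\,Q(x,dy)$, and for $\chi\in\mathcal{X}$ one sets $Q_\chi f(x)=\int_E f(y)\chi(x,y)\,Q(x,dy)$. The kernel $Q^\ell$ is the $\ell$-fold composition of $Q$ with itself. For a bounded operator $U$ on a complex Banach space $\mathcal{B}$, $r(U)$ is its spectral radius. The essential spectral radius $r_e(U)$ is the infimum of $r(U)$ and of the real numbers $\rho\ge 0$ for which $\mathcal{B}=F\oplus H$, where $F$ and $H$ are $U$-invariant subspaces such that $H$ is closed, $r(U|_H)<\rho$, $\dim F<+\infty$, and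 all eigenvalues of $U|_F$ have modulus $\ge\rho$. The operator $U$ is quasi-compact if $r_e(U)<r(U)$. For a probability measure $\nu$ on $(E,\mathcal{E})$, $\mathcal{H}_\nu$ is the set of measurable functions $\alpha:E\times E\to\mathbb{R}_+$ such that $$\lim_{m\to+\infty}\ \sup_{x\in E}\int_{\{y:\,\alpha(x,y)\ge m\}}\alpha(x,y)\,d\nu(y)=0,$$ and for $\alpha\in\mathcal{H}_\nu$, $T_{\nu,\alpha}$ is the bounded positive kernel $T_{\nu,\alpha}(x,A)=\int_A\alpha(x,y)\,d\nu(y)$. **Theorem.** Let $Q$ be a bounded positive kernel on $(E,\mathcal{E})$. Assume that there are an integer $\ell\ge1$, a probability measure $\nu$ on $(E,\mathcal{E})$ and $\alpha\in\mathcal{H}_\nu$ such that $S=Q^\ell-T_{\nu,\alpha}\ge0$, that is, $Q^\ell(x,A)\ge T_{\nu,\alpha}(x,A)$ for all $x\in E$ and $A\in\mathcal{E}$, and such that $r(S)^{1/\ell}<r(Q)$, where $r(S)$ and $r(Q)$ are the spectral radii on $\mathcal{B}$. Then: (i) the operator $Q$ on $\mathcal{B}$ is quasi-compact and $r_e(Q)\le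 r(S)^{1/\ell}$; (ii) if moreover $\ell=1$ or $\mathcal{E}$ is countably generated, then for every $\chi\in\mathcal{X}$ with $\|\chi\|\,r(S)^{1/\ell}<r(Q_\chi)$ the operator $Q_\chi$ on $\mathcal{B}$ is quasi-compact and $r_e(Q_\chi)\le\|\chi\|\,r(S)^{1/\ell}$. -/

import Mathlib

open MeasureTheory ProbabilityTheory Filter Topology
open scoped ENNReal NNReal

namespace KernelQC

/-! ### Bounded measurable functions -/

/-- The bounded measurable complex valued functions on `E`, as a subspace of `ℓ^∞(E, ℂ)`. -/
def bddMeasSubmodule (E : Type*) [MeasurableSpace E] : Submodule ℂ (lp (fun _ : E => ℂ) ∞) where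
  carrier := {f | Measurable (fun x => f x)}
  add_mem' := fun hf hg => Measurable.add hf hg
  zero_mem' := measurable_const
  smul_mem' := fun c _ hf => Measurable.const_smul hf c

/-- The space `𝓑(E)` of bounded measurable complex valued functions on `E`, with the supremum norm
`‖f‖ = ⨆ x, ‖f x‖`. -/
def BddMeas (E : Type*) [MeasurableSpace E] : Type _ := ↥(bddMeasSubmodule E)

namespace BddMeas

variable {E : Type*} [MeasurableSpace E]

noncomputable instance : NormedAddCommGroup (BddMeas E) :=
  inferInstanceAs (NormedAddCommGroup ↥(bddMeasSubmodule E))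

noncomputable instance : NormedSpace ℂ (BddMeas E) :=
  inferInstanceAs (NormedSpace ℂ ↥(bddMeasSubmodule E))

/-- The underlying function. -/
instance : CoeFun (BddMeas E) (fun _ => E → ℂ) := ⟨fun f x => f.1 x⟩

@[ext] lemma ext {f g : BddMeas E} (h : ∀ x, f x = g x) : f = g :=
  Subtype.ext (lp.ext (funext h))

lemma norm_eq_iSup (f : BddMeas E) : ‖f‖ = ⨆ x, ‖f x‖ := rfl

lemma measurable (f : BddMeas E) : Measurable (fun x => f x) := f.2

lemma norm_apply_le (f : BddMeas E) (x : E) : ‖f x‖ ≤ ‖f‖ :=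
  lp.norm_apply_le_norm ENNReal.top_ne_zero f.1 x

/-- A bounded measurable function, as an element of `𝓑(E)`. -/
def mk (f : E → ℂ) (hf : Measurable f) (C : ℝ) (hC : ∀ x, ‖f x‖ ≤ C) : BddMeas E :=
  ⟨⟨f, memℓp_infty ⟨C, by rintro _ ⟨x, rfl⟩; exact hC x⟩⟩, hf⟩

@[simp] lemma mk_apply (f : E → ℂ) (hf : Measurable f) (C : ℝ) (hC : ∀ x, ‖f x‖ ≤ C) (x : E) :
    mk f hf C hC x = f x := rfl

lemma norm_le {f : BddMeas E} {C : ℝ} (hC : 0 ≤ C) (h : ∀ x, ‖f x‖ ≤ C) : ‖f‖ ≤ C :=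
  lp.norm_le_of_forall_le hC h

/-- `𝓑(E)` is a Banach space. -/
instance : CompleteSpace (BddMeas E) := by
  suffices h : IsClosed (bddMeasSubmodule E : Set (lp (fun _ : E => ℂ) ∞)) from
    h.completeSpace_coe
  refine isClosed_of_closure_subset fun f hf => ?_
  obtain ⟨u, hu, hlim⟩ := mem_closure_iff_seq_limit.1 hf
  refine measurable_of_tendsto_metrizable (f := fun n x => u n x) (fun n => hu n) ?_
  refine tendsto_pi_nhds.2 fun x => ?_
  rw [tendsto_iff_norm_sub_tendsto_zero] at hlim ⊢
  exact squeeze_zero (fun _ => norm_nonneg _)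
    (fun n => lp.norm_apply_le_norm ENNReal.top_ne_zero (u n - f) x) hlim

end BddMeas

/-! ### The action of bounded positive kernels -/

section Action

variable {E : Type*} [MeasurableSpace E]

lemma integrable_mul (Q : Kernel E E) [IsFiniteKernel Q] (χ : BddMeas (E × E)) (f : BddMeas E)
    (x : E) : Integrable (fun y => f y * χ (x, y)) (Q x) := by
  refine Integrable.of_bound (C := ‖f‖ * ‖χ‖) ?_ (ae_of_all _ fun y => ?_)
  · exact (f.measurable.mul (χ.measurable.comp measurable_prodMk_left)).aestronglyMeasurable
  · rw [norm_mul]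
    exact mul_le_mul (f.norm_apply_le y) (χ.norm_apply_le _) (norm_nonneg _) (norm_nonneg _)

lemma norm_integral_le (Q : Kernel E E) [IsFiniteKernel Q] (g : E → ℂ) (C : ℝ)
    (hg : ∀ y, ‖g y‖ ≤ C) (hC : 0 ≤ C) (x : E) : ‖∫ y, g y ∂(Q x)‖ ≤ Q.bound.toReal * C := by
  refine (norm_integral_le_of_norm_le_const (ae_of_all _ hg)).trans ?_
  rw [mul_comm]
  refine mul_le_mul_of_nonneg_right ?_ hC
  exact ENNReal.toReal_mono Q.bound_ne_top (Q.measure_le_bound x _)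

/-- For a bounded positive kernel `Q` and a bounded measurable function `χ` on `E × E`, the bounded
operator `Q_χ f (x) = ∫ f(y) χ(x, y) Q(x, dy)` on `𝓑(E)`. -/
noncomputable def twistedOp (Q : Kernel E E) [IsFiniteKernel Q] (χ : BddMeas (E × E)) :
    BddMeas E →L[ℂ] BddMeas E :=
  have bound : ∀ (f : BddMeas E) (x : E),
      ‖∫ y, f y * χ (x, y) ∂(Q x)‖ ≤ Q.bound.toReal * (‖f‖ * ‖χ‖) := fun f x =>
    norm_integral_le Q _ _ (fun y => by
      rw [norm_mul]
      exact mul_le_mul (f.norm_apply_le y) (χ.norm_apply_le _) (norm_nonneg _) (norm_nonneg _))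
      (by positivity) x
  LinearMap.mkContinuous
    { toFun := fun f => BddMeas.mk (fun x => ∫ y, f y * χ (x, y) ∂(Q x))
        (StronglyMeasurable.integral_kernel_prod_right' (κ := Q)
          (f := fun p : E × E => f p.2 * χ p)
          ((f.measurable.comp measurable_snd).mul χ.measurable).stronglyMeasurable).measurable
        (Q.bound.toReal * (‖f‖ * ‖χ‖)) (bound f)
      map_add' := fun f g => by
        ext x
        change ∫ y, (f y + g y) * χ (x, y) ∂(Q x)
          = (∫ y, f y * χ (x, y) ∂(Q x)) + ∫ y, g y * χ (x, y) ∂(Q x)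
        rw [← integral_add (integrable_mul Q χ f x) (integrable_mul Q χ g x)]
        simp only [add_mul]
      map_smul' := fun c f => by
        ext x
        change ∫ y, (c * f y) * χ (x, y) ∂(Q x) = c * ∫ y, f y * χ (x, y) ∂(Q x)
        rw [← integral_const_mul]
        simp only [mul_assoc] }
    (Q.bound.toReal * ‖χ‖)
    (fun f => BddMeas.norm_le (by positivity) fun x => (bound f x).trans_eq (by ring))

/-- The bounded operator `Q f (x) = ∫ f(y) Q(x, dy)` on `𝓑(E)` defined by a bounded positive
kernel `Q`. -/
noncomputable def kernelOp (Q : Kernel E E) [IsFiniteKernel Q] : BddMeas E →L[ℂ] BddMeas E :=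
  LinearMap.mkContinuous
    { toFun := fun f => BddMeas.mk (fun x => ∫ y, f y ∂(Q x))
        (StronglyMeasurable.integral_kernel_prod_right' (κ := Q) (f := fun p : E × E => f p.2)
          (f.measurable.comp measurable_snd).stronglyMeasurable).measurable
        (Q.bound.toReal * ‖f‖)
        (fun x => norm_integral_le Q _ _ f.norm_apply_le (norm_nonneg _) x)
      map_add' := fun f g => by
        have h : ∀ (f : BddMeas E) (x : E), Integrable (fun y => f y) (Q x) := fun f x =>
          Integrable.of_bound (C := ‖f‖) f.measurable.aestronglyMeasurable
            (ae_of_all _ f.norm_apply_le)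
        ext x
        exact integral_add (h f x) (h g x)
      map_smul' := fun c f => by
        ext x
        exact integral_const_mul c _ }
    Q.bound.toReal
    (fun f => BddMeas.norm_le (by positivity) fun x =>
      norm_integral_le Q _ _ f.norm_apply_le (norm_nonneg _) x)

@[simp] lemma twistedOp_apply (Q : Kernel E E) [IsFiniteKernel Q] (χ : BddMeas (E × E))
    (f : BddMeas E) (x : E) : twistedOp Q χ f x = ∫ y, f y * χ (x, y) ∂(Q x) := rfl

@[simp] lemma kernelOp_apply (Q : Kernel E E) [IsFiniteKernel Q] (f : BddMeas E) (x : E) :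
    kernelOp Q f x = ∫ y, f y ∂(Q x) := rfl

end Action

/-! ### Absolutely continuous kernels with uniformly integrable densities -/

section Density

variable {E : Type*} [MeasurableSpace E]

/-- The set `ℋ_ν` of positive measurable functions `α` on `E × E` such that the functions
`α(x, ·)`, `x ∈ E`, are uniformly `ν`-integrable. -/
def UnifIntDensity (ν : Measure E) : Set (E × E → ℝ≥0) :=
  {α | Measurable α ∧
    Tendsto (fun m : ℝ≥0 => ⨆ x : E, ∫⁻ y in {y | m ≤ α (x, y)}, (α (x, y) : ℝ≥0∞) ∂ν)
      atTop (𝓝 0)}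

/-- The kernel `T_{ν,α}(x, A) = ∫_A α(x, y) dν(y)`. -/
noncomputable def densityKernel (ν : Measure E) [IsProbabilityMeasure ν]
    (α : UnifIntDensity ν) : Kernel E E :=
  Kernel.withDensity (Kernel.const E ν) (fun x y => (α.1 (x, y) : ℝ≥0∞))

lemma densityKernel_apply (ν : Measure E) [IsProbabilityMeasure ν]
    (α : UnifIntDensity ν) (x : E) (A : Set E) :
    densityKernel ν α x A = ∫⁻ y in A, (α.1 (x, y) : ℝ≥0∞) ∂ν := by
  unfold densityKernel
  rw [Kernel.withDensity_apply', Kernel.const_apply]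
  exact α.2.1.coe_nnreal_ennreal

instance (ν : Measure E) [IsProbabilityMeasure ν] (α : UnifIntDensity ν) :
    IsFiniteKernel (densityKernel ν α) := by
  obtain ⟨m, hm⟩ := (α.2.2.eventually (gt_mem_nhds one_pos)).exists
  refine ⟨⟨1 + m, by finiteness, fun x => ?_⟩⟩
  have hs : MeasurableSet {y | m ≤ α.1 (x, y)} :=
    measurableSet_le measurable_const (α.2.1.comp measurable_prodMk_left)
  rw [densityKernel_apply, setLIntegral_univ, ← lintegral_add_compl _ hs]
  refine add_le_add ((le_iSup (fun x : E =>
    ∫⁻ y in {y | m ≤ α.1 (x, y)}, (α.1 (x, y) : ℝ≥0∞) ∂ν) x).trans hm.le) ?_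
  calc ∫⁻ y in {y | m ≤ α.1 (x, y)}ᶜ, (α.1 (x, y) : ℝ≥0∞) ∂ν
      ≤ ∫⁻ _ in {y | m ≤ α.1 (x, y)}ᶜ, (m : ℝ≥0∞) ∂ν :=
        setLIntegral_mono measurable_const fun y hy => by
          have : α.1 (x, y) < m := not_le.1 hy
          exact_mod_cast this.le
    _ ≤ m := by
        rw [setLIntegral_const]
        exact mul_le_of_le_one_right' prob_le_one

end Density

/-! ### Essential spectral radius and quasi-compactness -/

section Essential

variable {B : Type*} [NormedAddCommGroup B] [NormedSpace ℂ B]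

/-- There is a decomposition `B = F ⊕ H` into `Q`-invariant subspaces with `H` closed and
`r(Q|_H) < ρ`, `F` finite dimensional and all eigenvalues of `Q|_F` of modulus `≥ ρ`. -/
def SplitsAt (Q : B →L[ℂ] B) (ρ : ℝ≥0) : Prop :=
  ∃ (F H : Submodule ℂ B) (hF : ∀ f ∈ F, Q f ∈ F) (hH : ∀ f ∈ H, Q f ∈ H),
    IsCompl F H ∧
    IsClosed (H : Set B) ∧
    spectralRadius ℂ ((Q.domRestrict H).codRestrict H fun f => hH f f.2) < ρ ∧
    FiniteDimensional ℂ F ∧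
    ∀ z : ℂ, Module.End.HasEigenvalue ((Q : B →ₗ[ℂ] B).restrict hF) z → ρ ≤ ‖z‖₊

/-- The essential spectral radius `r_e(Q)`: the infimum of `r(Q)` and of the real numbers `ρ ≥ 0`
at which `Q` splits. -/
noncomputable def essSpectralRadius (Q : B →L[ℂ] B) : ℝ≥0∞ :=
  sInf (insert (spectralRadius ℂ Q) {ρ : ℝ≥0∞ | ∃ s : ℝ≥0, SplitsAt Q s ∧ (s : ℝ≥0∞) = ρ})

/-- `Q` is quasi-compact when `r_e(Q) < r(Q)`. -/
def IsQuasiCompact (Q : B →L[ℂ] B) : Prop :=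
  essSpectralRadius Q < spectralRadius ℂ Q

end Essential

end KernelQC

/-! Write `U` for `Q` or `Q_χ` and `K` for `1` or `‖χ‖`. The aim is that `U` splits at every `ρ > K
r(S)^{1/l}`; both conclusions follow from this by the definition of `r_e`.

The power `U ^ l` is the operator of the kernel `Q ^ l` with a weight `c` bounded by `K ^ l`. This
is clear for `c = 1` or `l = 1`; in general `c` is a conditional expectation, and countable
generation of the σ-algebra makes it jointly measurable (`exists_twistedOp_pow`). Since `Q ^ l = T +
S`, it follows that `U ^ l = A + R`, where `A` and `R` are the operators of `T` and `S` with weight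
`c`. By positivity, `‖R ^ n‖ ≤ K ^ (l n) ‖S ^ n‖`.

Uniform integrability gives `A` two properties. A bounded sequence has a subsequence whose image
under `A` converges pointwise (truncate the density, then use weak compactness in `L²(ν)`), and `A`
sends bounded pointwise convergent sequences to norm convergent ones. As `R` preserves bounded
pointwise convergence, every `A R ^ j A` is compact (`isCompactOperator_twistedOp_mul_mul`).
Expanding `(A + R) ^ n`, all words with two or more letters `A` are compact, while the others have
total norm at most `(C + C' n) a ^ n`, where `a < ρ ^ l`. So some power `U ^ M` is `L + D` with `L`
compact and `8 ‖D‖ < ρ ^ M`.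

For such `U` the splitting is obtained by Riesz theory (`splitsAt_of_pow_eq_add`). The sum `F` of
the generalized eigenspaces for eigenvalues of modulus at least `ρ` is finite dimensional. Modulo
`F` no such eigenvalue remains, so by the Fredholm alternative the spectrum there lies in the open
disc of radius `ρ`. If `p` has its roots outside this disc and annihilates `F`, then `H = range
p(U)` is the required complement. -/

namespace KernelQC

/-! ### Polynomials with all roots outside a disc -/

section Splitting

open Polynomial

/-- Nonzero polynomials all of whose roots have modulus at least `ρ`. -/
def RootsOutside (ρ : ℝ) (p : ℂ[X]) : Prop :=
  p ≠ 0 ∧ ∀ z, p.IsRoot z → ρ ≤ ‖z‖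

lemma RootsOutside.one (ρ : ℝ) : RootsOutside ρ 1 :=
  ⟨one_ne_zero, fun z hz => by simp [IsRoot] at hz⟩

lemma RootsOutside.mul {ρ : ℝ} {p q : ℂ[X]} (hp : RootsOutside ρ p) (hq : RootsOutside ρ q) :
    RootsOutside ρ (p * q) :=
  ⟨mul_ne_zero hp.1 hq.1, fun z hz => (root_mul.1 hz).elim (hp.2 z) (hq.2 z)⟩

lemma RootsOutside.X_sub_C {ρ : ℝ} {z : ℂ} (hz : ρ ≤ ‖z‖) : RootsOutside ρ (X - C z) :=
  ⟨X_sub_C_ne_zero z, fun w hw => by rw [root_X_sub_C] at hw; rwa [← hw]⟩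

lemma RootsOutside.X_pow_sub_C {ρ : ℝ} {M : ℕ} (hM : M ≠ 0) {μ : ℂ} (hμ : ρ ^ M ≤ ‖μ‖) :
    RootsOutside ρ (X ^ M - C μ) := by
  refine ⟨X_pow_sub_C_ne_zero (Nat.pos_of_ne_zero hM) μ, fun z hz => ?_⟩
  have h : z ^ M = μ := by simpa [IsRoot, sub_eq_zero] using hz
  rw [← h, norm_pow] at hμ
  by_contra! hlt
  exact absurd hμ (not_le.2 (pow_lt_pow_left₀ hlt (norm_nonneg _) hM))

/-- Factorization over `ℂ` reduces questions about `p(U)` to its linear factors `U - z` with `ρ ≤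
‖z‖`. -/
lemma RootsOutside.induction {ρ : ℝ} {motive : ℂ[X] → Prop} {p : ℂ[X]} (hp : RootsOutside ρ p)
    (const : ∀ c : ℂ, c ≠ 0 → motive (C c))
    (mul : ∀ (z : ℂ) (q : ℂ[X]), ρ ≤ ‖z‖ → motive q → motive ((X - C z) * q)) : motive p := by
  have key : ∀ s : Multiset ℂ, (∀ z ∈ s, ρ ≤ ‖z‖) →
      motive ((s.map fun z => X - C z).prod * C p.leadingCoeff) := by
    intro s
    induction s using Multiset.induction with
    | empty => exact fun _ => by simpa using const _ (leadingCoeff_ne_zero.2 hp.1)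
    | cons z s ih =>
      intro h
      rw [Multiset.map_cons, Multiset.prod_cons, mul_assoc]
      exact mul z _ (h z (Multiset.mem_cons_self z s))
        (ih fun w hw => h w (Multiset.mem_cons_of_mem hw))
  rw [(IsAlgClosed.splits p).eq_prod_roots, mul_comm]
  exact key _ fun z hz => hp.2 z (isRoot_of_mem_roots hz)

variable {B : Type*} [NormedAddCommGroup B] [NormedSpace ℂ B]

lemma aeval_mul_apply (U : B →L[ℂ] B) (p q : ℂ[X]) (x : B) :
    aeval U (p * q) x = aeval U p (aeval U q x) := by rw [map_mul]; rfl

lemma aeval_comm_apply (U : B →L[ℂ] B) (p q : ℂ[X]) (x : B) :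
    aeval U p (aeval U q x) = aeval U q (aeval U p x) := by
  rw [← aeval_mul_apply, mul_comm, aeval_mul_apply]

lemma aeval_X_sub_C_apply (U : B →L[ℂ] B) (z : ℂ) (x : B) :
    aeval U (X - C z) x = U x - z • x := by
  simp [Algebra.algebraMap_eq_smul_one]

/-- The sum of the generalized eigenspaces of `U` for the eigenvalues of modulus at least `ρ`. -/
def outerSubspace (U : B →L[ℂ] B) (ρ : ℝ) : Submodule ℂ B where
  carrier := {x | ∃ p : ℂ[X], RootsOutside ρ p ∧ aeval U p x = 0}
  zero_mem' := ⟨1, RootsOutside.one ρ, map_zero _⟩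
  add_mem' := by
    rintro x y ⟨p, hp, hx⟩ ⟨q, hq, hy⟩
    refine ⟨p * q, hp.mul hq, ?_⟩
    rw [map_add, aeval_mul_apply, aeval_mul_apply, aeval_comm_apply U p q x, hx, hy]
    simp
  smul_mem' := by
    rintro c x ⟨p, hp, hx⟩
    exact ⟨p, hp, by rw [map_smul, hx, smul_zero]⟩

lemma aeval_mem_outerSubspace {U : B →L[ℂ] B} {ρ : ℝ} {x : B} (hx : x ∈ outerSubspace U ρ)
    (q : ℂ[X]) : aeval U q x ∈ outerSubspace U ρ := by
  obtain ⟨p, hp, hx⟩ := hx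
  exact ⟨p, hp, by rw [aeval_comm_apply, hx, map_zero]⟩

lemma map_mem_outerSubspace {U : B →L[ℂ] B} {ρ : ℝ} {x : B} (hx : x ∈ outerSubspace U ρ) :
    U x ∈ outerSubspace U ρ := by simpa using aeval_mem_outerSubspace hx X

lemma mem_outerSubspace_of_aeval_mem {U : B →L[ℂ] B} {ρ : ℝ} {x : B} {q : ℂ[X]}
    (hq : RootsOutside ρ q) (hx : aeval U q x ∈ outerSubspace U ρ) : x ∈ outerSubspace U ρ := by
  obtain ⟨p, hp, hx⟩ := hx
  exact ⟨p * q, hp.mul hq, by rw [aeval_mul_apply, hx]⟩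

lemma mem_outerSubspace_of_sub_smul_mem {U : B →L[ℂ] B} {ρ : ℝ} {x : B} {z : ℂ} (hz : ρ ≤ ‖z‖)
    (hx : U x - z • x ∈ outerSubspace U ρ) : x ∈ outerSubspace U ρ :=
  mem_outerSubspace_of_aeval_mem (RootsOutside.X_sub_C hz) (by rwa [aeval_X_sub_C_apply])

lemma le_norm_of_eigenvector_mem_outerSubspace {U : B →L[ℂ] B} {ρ : ℝ} {x : B} {z : ℂ}
    (hx : x ∈ outerSubspace U ρ) (hx0 : x ≠ 0) (hz : U x = z • x) : ρ ≤ ‖z‖ := by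
  obtain ⟨p, hp, hpx⟩ := hx
  refine hp.2 z ?_
  have h : ∀ q : ℂ[X], aeval U q x = q.eval z • x := fun q => by
    induction q using Polynomial.induction_on' with
    | add p q hp hq => simp [hp, hq, add_smul]
    | monomial n a =>
      have hn : (U ^ n) x = z ^ n • x := by
        induction n with
        | zero => simp
        | succ n ih =>
          rw [pow_succ', mul_apply_eq_comp, ih, map_smul, hz, smul_smul, pow_succ]
      rw [aeval_monomial, eval_monomial, mul_apply_eq_comp, hn]
      simp [Algebra.algebraMap_eq_smul_one, smul_smul, mul_comm]
  rw [h] at hpx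
  exact (smul_eq_zero.1 hpx).resolve_right hx0

/-- A proper invariant subspace of the outer subspace can be extended by one vector. -/
lemma exists_sub_smul_mem {U : B →L[ℂ] B} {ρ : ℝ} {E : Submodule ℂ B}
    (hE : E < outerSubspace U ρ) :
    ∃ y ∈ outerSubspace U ρ, y ∉ E ∧ ∃ z : ℂ, ρ ≤ ‖z‖ ∧ U y - z • y ∈ E := by
  obtain ⟨x, hx, hxE⟩ := SetLike.exists_of_lt hE
  obtain ⟨p, hp, hpx⟩ := id hx
  have hpx' : aeval U p x ∈ E := by rw [hpx]; exact zero_mem _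
  refine hp.induction (motive := fun p => aeval U p x ∈ E → ∃ y ∈ outerSubspace U ρ, y ∉ E ∧
    ∃ z : ℂ, ρ ≤ ‖z‖ ∧ U y - z • y ∈ E) (fun c hc h => ?_) (fun z q hz ih h => ?_) hpx'
  · rw [aeval_C, Algebra.algebraMap_eq_smul_one] at h
    exact absurd ((E.smul_mem_iff hc).1 (by simpa using h)) hxE
  -- Linear factors are stripped off until `q(U) x` leaves `E`; that vector is the required one.
  · by_cases hq : aeval U q x ∈ E
    · exact ih hq
    · rw [aeval_mul_apply, aeval_X_sub_C_apply] at h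
      exact ⟨_, aeval_mem_outerSubspace hx q, hq, z, hz, h⟩

/-- Riesz normalization of the vector in `exists_sub_smul_mem`. -/
lemma exists_unit_sub_smul_mem {U : B →L[ℂ] B} {ρ : ℝ} {E : Submodule ℂ B}
    [FiniteDimensional ℂ E] (hEU : ∀ x ∈ E, U x ∈ E) (hE : E < outerSubspace U ρ) :
    ∃ y ∈ outerSubspace U ρ, ‖y‖ = 1 ∧ (∀ e ∈ E, 1 / 2 ≤ ‖y - e‖) ∧
      ∃ z : ℂ, ρ ≤ ‖z‖ ∧ U y - z • y ∈ E := by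
  obtain ⟨y, hyF, hyE, z, hz, hyz⟩ := exists_sub_smul_mem hE
  have hclosed : IsClosed (E : Set B) := E.closed_of_finiteDimensional
  have hne : (E : Set B).Nonempty := ⟨0, E.zero_mem⟩
  have hpos : 0 < Metric.infDist y E := (hclosed.notMem_iff_infDist_pos hne).1 hyE
  -- An element of `E` nearly closest to `y`: the slack factor `2` becomes the distance `1 / 2`
  -- after normalization.
  obtain ⟨e, he, hlt⟩ := (Metric.infDist_lt_iff hne).1 (by linarith : Metric.infDist y E <
    2 * Metric.infDist y E)
  rw [dist_eq_norm] at hlt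
  have hne0 : 0 < ‖y - e‖ := norm_pos_iff.2 (sub_ne_zero.2 fun h => hyE (h ▸ he))
  have hc : ((‖y - e‖⁻¹ : ℝ) : ℂ) ≠ 0 := by
    exact_mod_cast inv_ne_zero hne0.ne'
  refine ⟨((‖y - e‖⁻¹ : ℝ) : ℂ) • (y - e),
    Submodule.smul_mem _ _ (Submodule.sub_mem _ hyF (hE.le he)), ?_, fun f hf => ?_, z, hz, ?_⟩
  · rw [norm_smul, Complex.norm_real, norm_inv, norm_norm, inv_mul_cancel₀ hne0.ne']
  · have h1 : ((‖y - e‖⁻¹ : ℝ) : ℂ) • (y - e) - f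
        = ((‖y - e‖⁻¹ : ℝ) : ℂ) • (y - (e + (‖y - e‖ : ℂ) • f)) := by
      rw [Complex.ofReal_inv, ← sub_sub, smul_sub _ (y - e), inv_smul_smul₀]
      exact_mod_cast hne0.ne'
    have h2 : Metric.infDist y E ≤ ‖y - (e + (‖y - e‖ : ℂ) • f)‖ := by
      rw [← dist_eq_norm]
      exact Metric.infDist_le_dist_of_mem (E.add_mem he (E.smul_mem _ hf))
    rw [h1, norm_smul, Complex.norm_real, norm_inv, norm_norm, inv_mul_eq_div,
      le_div_iff₀ hne0]
    linarith
  · have h1 : U (((‖y - e‖⁻¹ : ℝ) : ℂ) • (y - e)) - z • ((‖y - e‖⁻¹ : ℝ) : ℂ) • (y - e)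
        = ((‖y - e‖⁻¹ : ℝ) : ℂ) • ((U y - z • y) - (U e - z • e)) := by
      rw [map_smul, map_sub]
      module
    rw [h1]
    exact E.smul_mem _ (E.sub_mem hyz (E.sub_mem (hEU e he) (E.smul_mem _ he)))

lemma pow_sub_pow_smul_mem {U : B →L[ℂ] B} {E : Submodule ℂ B} (hEU : ∀ x ∈ E, U x ∈ E) {y : B}
    {z : ℂ} (hy : U y - z • y ∈ E) (n : ℕ) : (U ^ n) y - z ^ n • y ∈ E := by
  induction n with
  | zero => simp
  | succ n ih =>
    have : (U ^ (n + 1)) y - z ^ (n + 1) • y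
        = U ((U ^ n) y - z ^ n • y) + z ^ n • (U y - z • y) := by
      rw [pow_succ' U, mul_apply_eq_comp, map_sub, map_smul, smul_sub, smul_smul,
        pow_succ]
      abel
    rw [this]
    exact E.add_mem (hEU _ ih) (E.smul_mem _ hy)

lemma pow_mem_of_invariant {U : B →L[ℂ] B} {E : Submodule ℂ B} (hEU : ∀ x ∈ E, U x ∈ E) {y : B}
    (hy : y ∈ E) (n : ℕ) : (U ^ n) y ∈ E := by
  induction n with
  | zero => simpa
  | succ n ih => rw [pow_succ', mul_apply_eq_comp]; exact hEU _ ih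

/-- Riesz's argument: in infinite dimension there would be an increasing chain of invariant
subspaces with unit vectors far from the preceding ones. On these `U ^ M` separates by at least `ρ ^
M / 2`, and `D` can spoil at most `2 ‖D‖ < ρ ^ M / 4`, so their images under `L` would have no
Cauchy subsequence. -/
theorem finiteDimensional_outerSubspace {U L D : B →L[ℂ] B} {ρ : ℝ} (hρ : 0 < ρ) {M : ℕ}
    (hU : U ^ M = L + D) (hL : IsCompactOperator L) (hD : 8 * ‖D‖ < ρ ^ M) :
    FiniteDimensional ℂ (outerSubspace U ρ) := by
  classical
  set F := outerSubspace U ρ with hF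
  by_contra hfin
  let P : Submodule ℂ B × B → Prop := fun a => FiniteDimensional ℂ a.1 ∧ a.1 ≤ F ∧
    (∀ x ∈ a.1, U x ∈ a.1) ∧ ‖a.2‖ = 1 ∧ (∀ e ∈ a.1, 1 / 2 ≤ ‖a.2 - e‖) ∧ a.2 ∈ F ∧
      ∃ z : ℂ, ρ ≤ ‖z‖ ∧ U a.2 - z • a.2 ∈ a.1
  obtain ⟨f, hfP, hfr⟩ := exists_seq_of_forall_finset_exists P
    (fun a b => a.1 ≤ b.1 ∧ a.2 ∈ b.1) (by
      intro s hs
      let E : Submodule ℂ B := ⨆ a ∈ s, (a.1 ⊔ Submodule.span ℂ {a.2})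
      have hmem : ∀ a ∈ s, a.1 ⊔ Submodule.span ℂ {a.2} ≤ E := fun a ha =>
        le_iSup₂_of_le a ha le_rfl
      have hEF : E ≤ F := iSup₂_le fun a ha => sup_le (hs a ha).2.1
        ((Submodule.span_singleton_le_iff_mem _ _).2 (hs a ha).2.2.2.2.2.1)
      have hEU : ∀ x ∈ E, U x ∈ E := by
        have : E ≤ E.comap (U : B →ₗ[ℂ] B) := iSup₂_le fun a ha => by
          obtain ⟨-, -, h3, -, -, -, z, -, h7⟩ := hs a ha
          have ha1 : a.1 ≤ E := le_sup_left.trans (hmem a ha)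
          have ha2 : a.2 ∈ E :=
            hmem a ha (le_sup_right (a := a.1) (Submodule.mem_span_singleton_self a.2))
          refine sup_le (fun x hx => ha1 (h3 x hx)) ?_
          rw [Submodule.span_singleton_le_iff_mem]
          have := E.add_mem (ha1 h7) (E.smul_mem z ha2)
          simpa using this
        exact fun x hx => this hx
      have hEfin : FiniteDimensional ℂ E := by
        have : ∀ a : s, FiniteDimensional ℂ (a.1.1 ⊔ Submodule.span ℂ {a.1.2} : Submodule ℂ B) :=
          fun a => by
            have := (hs a.1 a.2).1
            infer_instance
        have hEeq : E = ⨆ a : s, (a.1.1 ⊔ Submodule.span ℂ {a.1.2}) := by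
          simp only [E, iSup_subtype]
        rw [hEeq]
        infer_instance
      have hlt : E < F := lt_of_le_of_ne hEF fun h => hfin (h ▸ hEfin)
      obtain ⟨y, h1, h2, h3, h4⟩ := exists_unit_sub_smul_mem hEU hlt
      exact ⟨(E, y), ⟨hEfin, hEF, hEU, h2, h3, h1, h4⟩, fun a ha =>
        ⟨le_sup_left.trans (hmem a ha),
          hmem a ha (le_sup_right (a := a.1) (Submodule.mem_span_singleton_self a.2))⟩⟩)
  have hsep : ∀ m n, m < n → ρ ^ M / 4 ≤ ‖L (f n).2 - L (f m).2‖ := by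
    intro m n hmn
    obtain ⟨hm1, hm2⟩ := hfr m n hmn
    obtain ⟨-, -, hEU, hn1, hn2, -, z, hz, hzE⟩ := hfP n
    obtain ⟨-, -, -, hm3, -⟩ := hfP m
    have hLU : ∀ x, L x = (U ^ M) x - D x := fun x => by rw [hU]; simp
    have he1 := pow_sub_pow_smul_mem hEU hzE M
    have he2 := pow_mem_of_invariant hEU hm2 M
    -- The vector `e` is chosen in the `n`-th subspace so that the difference of the images under `U
    -- ^ M` is exactly `z ^ M` times (`n`-th unit vector minus `e`).
    have hz0 : z ^ M ≠ 0 := pow_ne_zero _ (norm_pos_iff.1 (hρ.trans_le hz))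
    set e := (z ^ M)⁻¹ • ((U ^ M) (f m).2 - ((U ^ M) (f n).2 - z ^ M • (f n).2)) with he
    have heE : e ∈ (f n).1 := Submodule.smul_mem _ _ (Submodule.sub_mem _ he2 he1)
    have key : L (f n).2 - L (f m).2 = z ^ M • ((f n).2 - e) - (D (f n).2 - D (f m).2) := by
      rw [he, smul_sub, smul_inv_smul₀ hz0, hLU, hLU]
      abel
    have h1 : ρ ^ M * (1 / 2) ≤ ‖z ^ M • ((f n).2 - e)‖ := by
      rw [norm_smul, norm_pow]
      exact mul_le_mul (pow_le_pow_left₀ hρ.le hz M) (hn2 e heE) (by norm_num) (by positivity)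
    have h2 : ‖D (f n).2 - D (f m).2‖ ≤ 2 * ‖D‖ := by
      refine (norm_sub_le _ _).trans ?_
      have := D.le_opNorm (f n).2
      have := D.le_opNorm (f m).2
      rw [hn1] at *
      rw [hm3] at *
      linarith
    rw [key]
    have := norm_sub_norm_le (z ^ M • ((f n).2 - e)) (D (f n).2 - D (f m).2)
    linarith
  obtain ⟨K, hK, hLK⟩ := IsCompactOperator.image_closedBall_subset_compact
    (f := (L : B →ₗ[ℂ] B)) hL 1
  have hmemK : ∀ n, L (f n).2 ∈ K := fun n =>
    hLK ⟨(f n).2, by simp [(hfP n).2.2.2.1], rfl⟩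
  obtain ⟨a, -, φ, hφ, hlim⟩ := hK.tendsto_subseq hmemK
  obtain ⟨N, hN⟩ := Metric.cauchySeq_iff'.1 hlim.cauchySeq (ρ ^ M / 4) (by positivity)
  have h1 := hN (N + 1) (Nat.le_succ N)
  have h2 := hsep (φ N) (φ (N + 1)) (hφ (Nat.lt_succ_self N))
  rw [dist_eq_norm] at h1
  exact absurd h1 (not_lt.2 h2)

/-- A finite dimensional outer subspace is annihilated by one polynomial. -/
lemma exists_annihilator_outerSubspace {U : B →L[ℂ] B} {ρ : ℝ}
    [hfin : FiniteDimensional ℂ (outerSubspace U ρ)] :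
    ∃ p : ℂ[X], RootsOutside ρ p ∧ ∀ x ∈ outerSubspace U ρ, aeval U p x = 0 := by
  classical
  have key : ∀ s : Finset B, (∀ x ∈ s, x ∈ outerSubspace U ρ) →
      ∃ p : ℂ[X], RootsOutside ρ p ∧ ∀ x ∈ s, aeval U p x = 0 := by
    intro s
    induction s using Finset.induction with
    | empty => exact fun _ => ⟨1, RootsOutside.one ρ, by simp⟩
    | insert a s _ ih =>
      intro h
      obtain ⟨p, hp, hps⟩ := ih fun x hx => h x (Finset.mem_insert_of_mem hx)
      obtain ⟨q, hq, hqa⟩ := h a (Finset.mem_insert_self a s)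
      refine ⟨p * q, hp.mul hq, fun x hx => ?_⟩
      rw [aeval_mul_apply]
      rcases Finset.mem_insert.1 hx with rfl | hx
      · rw [hqa, map_zero]
      · rw [aeval_comm_apply, hps x hx, map_zero]
  obtain ⟨s, hs⟩ := (Submodule.fg_iff_finiteDimensional _).2 hfin
  obtain ⟨p, hp, hps⟩ := key s fun x hx => hs ▸ Submodule.subset_span hx
  refine ⟨p, hp, fun x hx => ?_⟩
  have hle : Submodule.span ℂ (s : Set B) ≤ LinearMap.ker (aeval U p : B →ₗ[ℂ] B) :=
    Submodule.span_le.2 fun y hy => hps y hy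
  rw [hs] at hle
  exact hle hx

end Splitting

/-! ### Invariant decompositions from powers close to compact operators. -/

section Splitting

open Polynomial

variable {B : Type*} [NormedAddCommGroup B] [NormedSpace ℂ B]

lemma RootsOutside.aeval_injective {U : B →L[ℂ] B} {ρ : ℝ}
    (hU : ∀ z : ℂ, ρ ≤ ‖z‖ → ∀ x, U x = z • x → x = 0) {p : ℂ[X]} (hp : RootsOutside ρ p) {x : B}
    (hx : aeval U p x = 0) : x = 0 := by
  refine hp.induction (motive := fun p => aeval U p x = 0 → x = 0) (fun c hc h => ?_)
    (fun z q hz ih h => ?_) hx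
  · rw [aeval_C, Algebra.algebraMap_eq_smul_one] at h
    exact (smul_eq_zero.1 h).resolve_left hc
  · rw [aeval_mul_apply, aeval_X_sub_C_apply] at h
    exact ih (hU z hz _ (sub_eq_zero.1 h))

lemma RootsOutside.isUnit_aeval {U : B →L[ℂ] B} {ρ : ℝ}
    (hU : ∀ z ∈ spectrum ℂ U, ‖z‖ < ρ) {p : ℂ[X]} (hp : RootsOutside ρ p) :
    IsUnit (aeval U p) := by
  refine hp.induction (motive := fun p => IsUnit (aeval U p)) (fun c hc => ?_)
    (fun z q hz ih => ?_)
  · rw [aeval_C]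
    exact hc.isUnit.map _
  · rw [map_mul]
    refine IsUnit.mul ?_ ih
    have : z ∉ spectrum ℂ U := fun h => absurd (hU z h) (not_lt.2 hz)
    rw [spectrum.notMem_iff] at this
    simpa using this.neg

/-- If `U ^ M` is a small perturbation of a compact operator and `U` has no eigenvalue of modulus
at least `ρ`, then the spectrum of `U` is contained in the open disc of radius `ρ`. -/
lemma norm_lt_of_mem_spectrum [CompleteSpace B] {U L D : B →L[ℂ] B} {ρ : ℝ} (hρ : 0 < ρ) {M : ℕ}
    (hM : M ≠ 0) (hUM : U ^ M = L + D) (hL : IsCompactOperator L) (hD : ‖D‖ < ρ ^ M)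
    (hU : ∀ z : ℂ, ρ ≤ ‖z‖ → ∀ x, U x = z • x → x = 0) {z : ℂ} (hz : z ∈ spectrum ℂ U) :
    ‖z‖ < ρ := by
  by_contra! hle
  have hμ : ρ ^ M ≤ ‖z ^ M‖ := by
    rw [norm_pow]
    exact pow_le_pow_left₀ hρ.le hle M
  refine spectrum.pow_mem_pow U M hz ?_
  rcases subsingleton_or_nontrivial B with hB | hB
  · exact isUnit_of_subsingleton _
  obtain ⟨u, hu⟩ : IsUnit (algebraMap ℂ (B →L[ℂ] B) (z ^ M) - D) := by
    have : z ^ M ∉ spectrum ℂ D := fun h =>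
      absurd (hD.trans_le hμ) (not_lt.2 (spectrum.norm_le_norm_of_mem h))
    rwa [spectrum.notMem_iff] at this
  -- Since `z ^ M - U ^ M = (z ^ M - D)(1 - K)` with `K` compact, the Fredholm alternative applies.
  -- A fixed vector of `K` would be killed by `U ^ M - z ^ M`, hence would yield an eigenvalue of
  -- `U` of modulus at least `ρ`.
  set K : B →L[ℂ] B := ↑u⁻¹ * L with hK
  have hKc : IsCompactOperator K := hL.clm_comp (↑u⁻¹ : B →L[ℂ] B)
  have hfac : algebraMap ℂ (B →L[ℂ] B) (z ^ M) - U ^ M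
      = (u : B →L[ℂ] B) * (algebraMap ℂ (B →L[ℂ] B) 1 - K) := by
    rw [hK, mul_sub, Units.mul_inv_cancel_left, map_one, mul_one, hu, hUM]
    abel
  change IsUnit (algebraMap ℂ (B →L[ℂ] B) (z ^ M) - U ^ M)
  rw [hfac]
  refine u.isUnit.mul ?_
  rcases hKc.hasEigenvalue_or_mem_resolventSet (one_ne_zero (α := ℂ)) with h | h
  · exfalso
    obtain ⟨x, hx⟩ := h.exists_hasEigenvector
    have hKx : K x = x := by simpa using hx.apply_eq_smul
    refine hx.2 ((RootsOutside.X_pow_sub_C hM hμ).aeval_injective hU ?_)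
    have h0 : (algebraMap ℂ (B →L[ℂ] B) (z ^ M) - U ^ M) x = 0 := by
      rw [hfac, mul_apply_eq_comp]
      simp [hKx]
    rw [map_sub, map_pow, aeval_X, aeval_C, ← neg_sub, neg_apply, h0, neg_zero]
  · exact h

lemma aeval_semiconj {U V q : B →L[ℂ] B} (h : q * U = V * q) (p : ℂ[X]) :
    q * aeval U p = aeval V p * q := by
  induction p using Polynomial.induction_on' with
  | add p₁ p₂ h₁ h₂ => rw [map_add, map_add, mul_add, add_mul, h₁, h₂]
  | monomial n a =>
    have hn : q * U ^ n = V ^ n * q := (SemiconjBy.pow_right (show SemiconjBy q U V from h) n)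
    rw [aeval_monomial, aeval_monomial, ← mul_assoc, ← Algebra.commutes, mul_assoc, hn, mul_assoc]

lemma spectralRadius_lt_of_forall_bijective [CompleteSpace B] {T : B →L[ℂ] B} {ρ : ℝ≥0}
    (hρ : 0 < ρ) (hT : ∀ z : ℂ, (ρ : ℝ) ≤ ‖z‖ →
      (∀ x, T x = z • x → x = 0) ∧ ∀ y, ∃ x, T x - z • x = y) :
    spectralRadius ℂ T < ρ := by
  rcases subsingleton_or_nontrivial B with hs | hs
  · rw [spectrum.SpectralRadius.of_subsingleton]
    exact_mod_cast hρ
  refine spectrum.spectralRadius_lt_of_forall_lt T fun z hz => ?_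
  by_contra! hle
  obtain ⟨h1, h2⟩ := hT z hle
  refine hz ?_
  rw [spectrum.mem_resolventSet_iff, ContinuousLinearMap.isUnit_iff_bijective]
  have hval : ∀ x, (algebraMap ℂ (B →L[ℂ] B) z - T) x = z • x - T x := fun x => by
    simp [Algebra.algebraMap_eq_smul_one]
  refine ⟨(injective_iff_map_eq_zero _).2 fun x hx => h1 x ?_, fun y => ?_⟩
  · rw [hval, sub_eq_zero] at hx
    exact hx.symm
  · obtain ⟨x, hx⟩ := h2 y
    exact ⟨-x, by rw [hval, ← hx, map_neg]; module⟩

/-- If some power of `U` is a small perturbation of a compact operator, then `U` splits. -/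
theorem splitsAt_of_pow_eq_add [CompleteSpace B] {U L D : B →L[ℂ] B} {ρ : ℝ≥0} (hρ : 0 < ρ) {M : ℕ}
    (hM : M ≠ 0) (hUM : U ^ M = L + D) (hL : IsCompactOperator L)
    (hD : 8 * ‖D‖ < (ρ : ℝ) ^ M) : SplitsAt U ρ := by
  have hρ' : (0 : ℝ) < ρ := hρ
  set F := outerSubspace U ρ with hF
  have hfin : FiniteDimensional ℂ F := finiteDimensional_outerSubspace hρ' hUM hL hD
  have hFproper : ProperSpace F := FiniteDimensional.proper ℂ F
  obtain ⟨π, hπ⟩ := Submodule.ClosedComplemented.of_finiteDimensional F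
  -- A continuous projection with kernel `F`; `V = q U` models on `B` the operator induced by `U` on
  -- `B / F`.
  set q : B →L[ℂ] B := 1 - F.subtypeL ∘L π with hq
  have hqF : ∀ x ∈ F, q x = 0 := fun x hx => by
    have := hπ ⟨x, hx⟩
    simp [hq, this]
  have hFq : ∀ x, q x = 0 → x ∈ F := fun x hx => by
    have : x = π x := by simpa [hq, sub_eq_zero] using hx
    rw [this]
    exact (π x).2
  have hqq : ∀ T : B →L[ℂ] B, (∀ x ∈ F, T x ∈ F) → q * T * q = q * T := fun T hT => by
    ext x
    have : q (T (π x)) = 0 := hqF _ (hT _ (π x).2)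
    have hx : q x = x - π x := by simp [hq]
    simp [hx, this]
  set V : B →L[ℂ] B := q * U with hV
  have hVq : V * q = V := hqq U fun x hx => map_mem_outerSubspace hx
  have hqid : q * q = q := by simpa using hqq 1 fun x hx => hx
  have hqV : q * V = V := by rw [hV, ← mul_assoc, hqid]
  have hsemi : ∀ p : ℂ[X], q * aeval U p = aeval V p * q := aeval_semiconj (by rw [hVq])
  have hcomm : ∀ p : ℂ[X], q * aeval V p = aeval V p * q := aeval_semiconj (by rw [hVq, hqV])
  -- Here `V ^ M = q L + q D`. The finite rank part of `q D` joins the compact term, so the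
  -- remainder is `D` itself and `‖q‖` does not enter the estimate.
  have hVM : V ^ M = (q * L - F.subtypeL ∘L π ∘L D) + D := by
    have h1 : q * U ^ M = V ^ M * q := by simpa using hsemi (X ^ M)
    have h2 : V ^ M * q = V ^ M := by
      obtain ⟨m, rfl⟩ := Nat.exists_eq_succ_of_ne_zero hM
      rw [Nat.succ_eq_add_one, pow_succ, mul_assoc, hVq]
    rw [← h2, ← h1, hUM, mul_add]
    ext x
    simp [hq]
    abel
  have hLc : IsCompactOperator (q * L - F.subtypeL ∘L π ∘L D : B →L[ℂ] B) := by
    refine IsCompactOperator.sub (hL.clm_comp q) ?_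
    exact (isCompactOperator_of_locallyCompactSpace_dom (π ∘L D)).clm_comp F.subtypeL
  have hVspec : ∀ z ∈ spectrum ℂ V, ‖z‖ < ρ := by
    refine fun z hz => norm_lt_of_mem_spectrum hρ' hM hVM hLc ?_ (fun w hw x hx => ?_) hz
    · have := norm_nonneg D
      linarith
    -- An eigenvector `x` of `V` satisfies `q x = x` and `U x - w • x ∈ F`. The latter puts `x` in
    -- `F`, where `q` vanishes.
    · have hw0 : w ≠ 0 := norm_pos_iff.1 (hρ'.trans_le hw)
      have h1 : q x = x := by
        have : q (w • x) = w • x := by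
          rw [← hx, ← mul_apply_eq_comp, hqV]
        rw [map_smul] at this
        exact smul_right_injective B hw0 this
      have h2 : x ∈ F := by
        refine mem_outerSubspace_of_sub_smul_mem hw (hFq _ ?_)
        rw [map_sub, map_smul, h1, ← mul_apply_eq_comp, ← hV, hx, sub_self]
      rw [← h1, hqF x h2]
  -- `p(U)` is surjective modulo `F`, with `G = p(V)⁻¹`, because `q p(U) = p(V) q` and `q` commutes
  -- with `p(V)`.
  have hsurj : ∀ p : ℂ[X], RootsOutside ρ p → ∃ G : B →L[ℂ] B, ∀ y, y - aeval U p (G y) ∈ F := by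
    intro p hp
    obtain ⟨u, hu⟩ := hp.isUnit_aeval hVspec
    refine ⟨↑u⁻¹, fun y => hFq _ ?_⟩
    have h1 : q * (aeval U p * ↑u⁻¹) = q := by
      have h2 : Commute q (u : B →L[ℂ] B) := by rw [hu]; exact hcomm p
      rw [← mul_assoc, hsemi, ← hu, mul_assoc, (h2.units_inv_right).eq, Units.mul_inv_cancel_left]
    have h3 : q (aeval U p ((↑u⁻¹ : B →L[ℂ] B) y)) = q y := by
      conv_rhs => rw [← h1]
      rfl
    rw [map_sub, h3, sub_self]
  obtain ⟨p, hp, hpF⟩ := exists_annihilator_outerSubspace (U := U) (ρ := ρ)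
  set H : Submodule ℂ B := LinearMap.range (aeval U p : B →ₗ[ℂ] B) with hH
  have hmemH : ∀ x, aeval U p x ∈ H := fun x => ⟨x, rfl⟩
  -- If `p(U) y ∈ F` then already `y ∈ F`, which `p(U)` annihilates.
  have hdisj : ∀ x ∈ F, x ∈ H → x = 0 := by
    rintro x hxF ⟨y, rfl⟩
    exact hpF y (mem_outerSubspace_of_aeval_mem hp hxF)
  have hUH : ∀ x ∈ H, U x ∈ H := by
    rintro _ ⟨y, rfl⟩
    exact ⟨U y, by simpa using aeval_comm_apply U p X y⟩
  obtain ⟨G, hG⟩ := hsurj p hp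
  have hclosed : IsClosed (H : Set B) := by
    have : (H : Set B) = {x | x - aeval U p (G x) = 0} := by
      ext x
      refine ⟨fun hx => hdisj _ (hG x) (H.sub_mem hx (hmemH _)), fun hx => ?_⟩
      rw [SetLike.mem_coe, sub_eq_zero.1 hx]
      exact hmemH _
    rw [this]
    exact isClosed_eq (by fun_prop) continuous_const
  refine ⟨F, H, fun x hx => map_mem_outerSubspace hx, hUH, ?_, hclosed, ?_, hfin, ?_⟩
  · refine IsCompl.of_eq (eq_bot_iff.2 fun x hx => hdisj x hx.1 hx.2) (eq_top_iff.2 fun x _ => ?_)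
    rw [← sub_add_cancel x (aeval U p (G x))]
    exact Submodule.add_mem_sup (hG x) (hmemH _)
  · have hHc : CompleteSpace H := hclosed.completeSpace_coe
    refine spectralRadius_lt_of_forall_bijective hρ fun z hle' => ⟨?_, ?_⟩
    · intro x hx
      refine Subtype.ext (hdisj x (mem_outerSubspace_of_sub_smul_mem hle' ?_) x.2)
      have h1 : U x = z • (x : B) := congrArg Subtype.val hx
      rw [h1, sub_self]
      exact zero_mem _
    · rintro ⟨y, hy⟩
      -- The extra factor `p` places the approximate preimage of `y` in `H`; the error then lies in
      -- `F ∩ H = 0`.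
      obtain ⟨G', hG'⟩ := hsurj ((X - C z) * p) ((RootsOutside.X_sub_C hle').mul hp)
      have h1 := hG' y
      rw [aeval_mul_apply, aeval_X_sub_C_apply] at h1
      have h2 := hdisj _ h1 (H.sub_mem hy (H.sub_mem (hUH _ (hmemH _)) (H.smul_mem _ (hmemH _))))
      exact ⟨⟨aeval U p (G' y), hmemH _⟩, Subtype.ext (sub_eq_zero.1 h2).symm⟩
  · intro z hz
    obtain ⟨x, hx⟩ := hz.exists_hasEigenvector
    refine le_norm_of_eigenvector_mem_outerSubspace x.2 (fun h => hx.2 (Subtype.ext h)) ?_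
    exact congrArg Subtype.val hx.apply_eq_smul

end Splitting

/-! ### Powers of a perturbation of a compact operator -/

section Powers

variable {B : Type*} [NormedAddCommGroup B] [NormedSpace ℂ B]

/-- The sum of the words `R ^ j * A * R ^ (n - 1 - j)`. -/
noncomputable def singleWords (A R : B →L[ℂ] B) : ℕ → (B →L[ℂ] B)
  | 0 => 0
  | n + 1 => A * R ^ n + R * singleWords A R n

/-- Every word arising here begins with some `A R ^ i A`. The free exponent `k` absorbs the letter
`R` that the recursion of `singleWords` puts in front. -/
lemma isCompactOperator_mul_singleWords {A R : B →L[ℂ] B}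
    (hA : ∀ j, IsCompactOperator (A * R ^ j * A : B →L[ℂ] B)) (n : ℕ) :
    ∀ k, IsCompactOperator (A * R ^ k * singleWords A R n : B →L[ℂ] B) := by
  induction n with
  | zero =>
    intro k
    rw [singleWords, mul_zero]
    exact isCompactOperator_zero
  | succ n ih =>
    intro k
    rw [singleWords, mul_add, ← mul_assoc, ← mul_assoc, mul_assoc A (R ^ k) R, ← pow_succ]
    exact ((hA k).comp_clm (R ^ n)).add (ih (k + 1))

/-- `L` collects the words with at least two letters `A`. Multiplying on the left by `A + R` creates
new ones only from `A` times the single words. -/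
lemma exists_compact_add_pow_eq {A R : B →L[ℂ] B}
    (hA : ∀ j, IsCompactOperator (A * R ^ j * A : B →L[ℂ] B)) (n : ℕ) :
    ∃ L : B →L[ℂ] B, IsCompactOperator L ∧ (A + R) ^ n = L + (R ^ n + singleWords A R n) := by
  induction n with
  | zero => exact ⟨0, isCompactOperator_zero, by simp [singleWords]⟩
  | succ n ih =>
    obtain ⟨L, hL, h⟩ := ih
    refine ⟨A * L + R * L + A * singleWords A R n,
      ((hL.clm_comp A).add (hL.clm_comp R)).add ?_, ?_⟩
    · have := isCompactOperator_mul_singleWords hA n 0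
      rwa [pow_zero, mul_one] at this
    · rw [pow_succ', h, singleWords, pow_succ' R]
      noncomm_ring

lemma norm_pow_mul_singleWords_le {A R : B →L[ℂ] B} {C a : ℝ} (hC : 0 ≤ C) (ha : 0 < a)
    (hR : ∀ n, ‖R ^ n‖ ≤ C * a ^ n) (n : ℕ) :
    ∀ k, ‖R ^ k * singleWords A R n‖ ≤ n * (C * ‖A‖ * C / a) * a ^ (k + n) := by
  induction n with
  | zero => intro k; simp [singleWords]
  | succ n ih =>
    intro k
    rw [singleWords, mul_add, ← mul_assoc, ← mul_assoc, ← pow_succ]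
    refine (norm_add_le _ _).trans ?_
    have h1 : ‖R ^ k * A * R ^ n‖ ≤ (C * a ^ k) * ‖A‖ * (C * a ^ n) :=
      (norm_mul_le _ _).trans (mul_le_mul ((norm_mul_le _ _).trans
        (mul_le_mul_of_nonneg_right (hR k) (norm_nonneg _))) (hR n) (norm_nonneg _) (by positivity))
    refine (add_le_add h1 (ih (k + 1))).trans_eq ?_
    push_cast
    field_simp
    ring

/-- If `U ^ l = A + R`, the operators `A R ^ j A` are compact and the powers of `R` grow more slowly
than `ρ ^ l`, then `U` splits at `ρ`. -/
theorem splitsAt_of_pow_eq_add_of_compact [CompleteSpace B] {U A R : B →L[ℂ] B} {l : ℕ} (hl : l ≠ 0)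
    {ρ : ℝ≥0} (hρ : 0 < ρ) (hU : U ^ l = A + R)
    (hA : ∀ j, IsCompactOperator (A * R ^ j * A : B →L[ℂ] B))
    {C a : ℝ} (hC : 0 ≤ C) (ha : 0 < a) (haρ : a < (ρ : ℝ) ^ l) (hR : ∀ n, ‖R ^ n‖ ≤ C * a ^ n) :
    SplitsAt U ρ := by
  have hρ' : (0 : ℝ) < ρ := hρ
  have ht : 0 < (ρ : ℝ) ^ l := by positivity
  have hlim : Tendsto (fun n : ℕ => 8 * (C * (a / (ρ : ℝ) ^ l) ^ n
      + (C * ‖A‖ * C / a) * (n * (a / (ρ : ℝ) ^ l) ^ n))) atTop (𝓝 0) := by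
    have h0 : 0 ≤ a / (ρ : ℝ) ^ l := by positivity
    have h1 : a / (ρ : ℝ) ^ l < 1 := (div_lt_one ht).2 haρ
    have := ((tendsto_pow_atTop_nhds_zero_of_lt_one h0 h1).const_mul C).add
      ((tendsto_self_mul_const_pow_of_lt_one h0 h1).const_mul (C * ‖A‖ * C / a))
    simpa using this.const_mul 8
  -- The `n` single words cost only a linear factor, which the geometric decay beats. The exponent
  -- used is `M = l * n`, hence `n ≠ 0`.
  obtain ⟨n, hn, hn0⟩ := ((hlim.eventually (gt_mem_nhds one_pos)).and
    (eventually_ne_atTop 0)).exists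
  obtain ⟨L, hL, hpow⟩ := exists_compact_add_pow_eq hA n
  refine splitsAt_of_pow_eq_add hρ (mul_ne_zero hl hn0) (by rw [pow_mul, hU, hpow]) hL ?_
  have h1 : ‖R ^ n + singleWords A R n‖ ≤ C * a ^ n + n * (C * ‖A‖ * C / a) * a ^ n := by
    refine (norm_add_le _ _).trans (add_le_add (hR n) ?_)
    simpa using norm_pow_mul_singleWords_le hC ha hR n 0
  have h2 := mul_lt_mul_of_pos_right hn (pow_pos ht n)
  rw [div_pow] at h2
  rw [pow_mul]
  calc 8 * ‖R ^ n + singleWords A R n‖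
      ≤ 8 * (C * a ^ n + n * (C * ‖A‖ * C / a) * a ^ n) := by linarith
    _ = 8 * (C * (a ^ n / ((ρ : ℝ) ^ l) ^ n)
        + (C * ‖A‖ * C / a) * (n * (a ^ n / ((ρ : ℝ) ^ l) ^ n))) * ((ρ : ℝ) ^ l) ^ n := by
      field_simp
    _ < ((ρ : ℝ) ^ l) ^ n := by linarith

/-- Gelfand's formula gives the bound for large `n`; the constant absorbs the finitely many other
powers. -/
lemma exists_norm_pow_le_of_spectralRadius_lt [CompleteSpace B] {S : B →L[ℂ] B} {b : ℝ≥0}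
    (hb : spectralRadius ℂ S < b) : ∃ C : ℝ, 0 ≤ C ∧ ∀ n, ‖S ^ n‖ ≤ C * (b : ℝ) ^ n := by
  have hb0 : 0 < b := by
    have : (0 : ℝ≥0∞) < b := (zero_le).trans_lt hb
    exact_mod_cast this
  have hev := (spectrum.pow_nnnorm_pow_one_div_tendsto_nhds_spectralRadius S).eventually
    (gt_mem_nhds hb)
  obtain ⟨N, hN⟩ := eventually_atTop.1 (hev.and (eventually_ne_atTop 0))
  have hlarge : ∀ n, N ≤ n → ‖S ^ n‖ ≤ (b : ℝ) ^ n := by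
    intro n hn
    obtain ⟨h1, h0⟩ := hN n hn
    have h0' : (0 : ℝ) < n := by exact_mod_cast Nat.pos_of_ne_zero h0
    have h2 := ENNReal.rpow_le_rpow h1.le h0'.le
    rw [← ENNReal.rpow_mul, one_div, inv_mul_cancel₀ h0'.ne', ENNReal.rpow_one,
      ENNReal.rpow_natCast] at h2
    exact_mod_cast h2
  have hb' : (0 : ℝ) < b := hb0
  refine ⟨1 + ∑ k ∈ Finset.range N, ‖S ^ k‖ / (b : ℝ) ^ k, by positivity, fun n => ?_⟩
  have hbn : 0 < (b : ℝ) ^ n := by positivity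
  rw [← div_le_iff₀ hbn]
  rcases le_or_gt N n with hn | hn
  · have h1 : ‖S ^ n‖ / (b : ℝ) ^ n ≤ 1 := (div_le_one hbn).2 (hlarge n hn)
    have h2 : 0 ≤ ∑ k ∈ Finset.range N, ‖S ^ k‖ / (b : ℝ) ^ k := by positivity
    linarith
  · have := Finset.single_le_sum (f := fun k => ‖S ^ k‖ / (b : ℝ) ^ k)
      (fun k _ => by positivity) (Finset.mem_range.2 hn)
    linarith

end Powers

/-! ### Algebra of kernel operators -/

section KernelAlgebra

variable {E : Type*} [MeasurableSpace E]

lemma integrable_bddMeas (μ : Measure E) [IsFiniteMeasure μ] (f : BddMeas E) :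
    Integrable (fun y => f y) μ :=
  Integrable.of_bound (C := ‖f‖) f.measurable.aestronglyMeasurable (ae_of_all _ f.norm_apply_le)

instance isFiniteKernel_mul (κ η : Kernel E E) [IsFiniteKernel κ] [IsFiniteKernel η] :
    IsFiniteKernel (κ * η) :=
  inferInstanceAs (IsFiniteKernel (κ ∘ₖ η))

instance isFiniteKernel_pow (Q : Kernel E E) [IsFiniteKernel Q] (n : ℕ) :
    IsFiniteKernel (Q ^ n) := by
  induction n with
  | zero => exact inferInstanceAs (IsFiniteKernel Kernel.id)
  | succ n ih =>
    rw [pow_succ]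
    infer_instance

/-- The constant function `1` on `E × E`. -/
noncomputable def unitWeight (E : Type*) [MeasurableSpace E] : BddMeas (E × E) :=
  BddMeas.mk (fun _ => 1) measurable_const 1 fun _ => by simp

lemma norm_unitWeight_le : ‖unitWeight E‖ ≤ 1 :=
  BddMeas.norm_le zero_le_one fun _ => by simp [unitWeight]

lemma twistedOp_unitWeight (Q : Kernel E E) [IsFiniteKernel Q] :
    twistedOp Q (unitWeight E) = kernelOp Q := by
  ext f x
  simp [unitWeight]

lemma kernelOp_congr {κ η : Kernel E E} [IsFiniteKernel κ] [IsFiniteKernel η] (h : κ = η) :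
    kernelOp κ = kernelOp η := by
  subst h
  rfl

lemma twistedOp_congr {κ η : Kernel E E} [IsFiniteKernel κ] [IsFiniteKernel η] (h : κ = η)
    (c : BddMeas (E × E)) : twistedOp κ c = twistedOp η c := by
  subst h
  rfl

lemma kernelOp_comp (κ η : Kernel E E) [IsFiniteKernel κ] [IsFiniteKernel η] :
    kernelOp (η ∘ₖ κ) = kernelOp κ * kernelOp η := by
  ext f x
  rw [kernelOp_apply, Kernel.integral_comp (integrable_bddMeas _ f)]
  rfl

lemma kernelOp_pow (Q : Kernel E E) [IsFiniteKernel Q] (n : ℕ) :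
    kernelOp (Q ^ n) = kernelOp Q ^ n := by
  induction n with
  | zero =>
    ext f x
    have : (Q ^ 0) x = Measure.dirac x := by rw [pow_zero]; exact Kernel.id_apply x
    rw [kernelOp_apply, this, integral_dirac' _ _ f.measurable.stronglyMeasurable]
    rfl
  | succ n ih =>
    rw [pow_succ' (kernelOp Q), ← ih, ← kernelOp_comp]
    exact kernelOp_congr (pow_succ Q n)

/-- The difference of two kernels. -/
noncomputable def subKernel (κ η : Kernel E E) [IsFiniteKernel η] (h : ∀ x, η x ≤ κ x) :
    Kernel E E where
  toFun x := κ x - η x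
  measurable' := by
    refine Measure.measurable_of_measurable_coe _ fun s hs => ?_
    simp only [Measure.sub_apply hs (h _)]
    exact (κ.measurable_coe hs).sub (η.measurable_coe hs)

lemma subKernel_apply_add (κ η : Kernel E E) [IsFiniteKernel η] (h : ∀ x, η x ≤ κ x) (x : E) :
    subKernel κ η h x + η x = κ x :=
  Measure.sub_add_cancel_of_le (h x)

instance (κ η : Kernel E E) [IsFiniteKernel κ] [IsFiniteKernel η] (h : ∀ x, η x ≤ κ x) :
    IsFiniteKernel (subKernel κ η h) :=
  ⟨⟨κ.bound, κ.bound_lt_top, fun x =>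
    (Measure.sub_le Set.univ).trans (κ.measure_le_bound x Set.univ)⟩⟩

lemma twistedOp_subKernel (κ η : Kernel E E) [IsFiniteKernel κ] [IsFiniteKernel η]
    (h : ∀ x, η x ≤ κ x) (c : BddMeas (E × E)) :
    twistedOp κ c = twistedOp η c + twistedOp (subKernel κ η h) c := by
  ext f x
  change ∫ y, f y * c (x, y) ∂(κ x) =
    ∫ y, f y * c (x, y) ∂(η x) + ∫ y, f y * c (x, y) ∂(subKernel κ η h x)
  rw [add_comm, ← integral_add_measure (integrable_mul _ c f x) (integrable_mul η c f x),
    subKernel_apply_add]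

lemma kernelOp_subKernel (κ η : Kernel E E) [IsFiniteKernel κ] [IsFiniteKernel η]
    (h : ∀ x, η x ≤ κ x) : kernelOp (subKernel κ η h) = kernelOp κ - kernelOp η := by
  rw [eq_sub_iff_add_eq', ← twistedOp_unitWeight, ← twistedOp_unitWeight, ← twistedOp_unitWeight,
    ← twistedOp_subKernel]

/-- The constant function `1` on `E`. -/
noncomputable def unitFun (E : Type*) [MeasurableSpace E] : BddMeas E :=
  BddMeas.mk (fun _ => 1) measurable_const 1 fun _ => by simp

/-- Positivity of `σ` lets the iterates be dominated by those of the constant function `1`. The real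
part only serves to state this inequality in `ℝ`. -/
lemma norm_twistedOp_pow_apply_le (σ : Kernel E E) [IsFiniteKernel σ] (c : BddMeas (E × E))
    (f : BddMeas E) (n : ℕ) (x : E) :
    ‖((twistedOp σ c) ^ n) f x‖ ≤ ‖c‖ ^ n * ‖f‖ * (((kernelOp σ) ^ n) (unitFun E) x).re := by
  induction n generalizing x with
  | zero => simpa [unitFun] using f.norm_apply_le x
  | succ n ih =>
    rw [pow_succ' (twistedOp σ c), pow_succ' (kernelOp σ), mul_apply_eq_comp, mul_apply_eq_comp,
      twistedOp_apply, kernelOp_apply]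
    have hint := integrable_bddMeas (σ x) (((kernelOp σ) ^ n) (unitFun E))
    have hre : (∫ y, ((kernelOp σ) ^ n) (unitFun E) y ∂(σ x)).re
        = ∫ y, (((kernelOp σ) ^ n) (unitFun E) y).re ∂(σ x) := (integral_re hint).symm
    rw [hre, ← integral_const_mul]
    refine norm_integral_le_of_norm_le (hint.re.const_mul _) (ae_of_all _ fun y => ?_)
    rw [norm_mul]
    calc ‖((twistedOp σ c) ^ n) f y‖ * ‖c (x, y)‖
        ≤ (‖c‖ ^ n * ‖f‖ * (((kernelOp σ) ^ n) (unitFun E) y).re) * ‖c‖ :=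
          mul_le_mul (ih y) (c.norm_apply_le _) (norm_nonneg _) ((norm_nonneg _).trans (ih y))
      _ = ‖c‖ ^ (n + 1) * ‖f‖ * (((kernelOp σ) ^ n) (unitFun E) y).re := by ring

lemma norm_twistedOp_pow_le (σ : Kernel E E) [IsFiniteKernel σ] (c : BddMeas (E × E)) (n : ℕ) :
    ‖(twistedOp σ c) ^ n‖ ≤ ‖c‖ ^ n * ‖(kernelOp σ) ^ n‖ := by
  have h1 : ‖unitFun E‖ ≤ 1 := BddMeas.norm_le zero_le_one fun _ => by simp [unitFun]
  refine ContinuousLinearMap.opNorm_le_bound _ (by positivity) fun f => ?_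
  refine BddMeas.norm_le (by positivity) fun x => (norm_twistedOp_pow_apply_le σ c f n x).trans ?_
  have h2 : (((kernelOp σ) ^ n) (unitFun E) x).re ≤ ‖(kernelOp σ) ^ n‖ := by
    refine (Complex.re_le_norm _).trans ((BddMeas.norm_apply_le _ x).trans ?_)
    refine (ContinuousLinearMap.le_opNorm _ _).trans ?_
    exact mul_le_of_le_one_right (norm_nonneg _) h1
  calc ‖c‖ ^ n * ‖f‖ * (((kernelOp σ) ^ n) (unitFun E) x).re
      ≤ ‖c‖ ^ n * ‖f‖ * ‖(kernelOp σ) ^ n‖ := by gcongr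
    _ = ‖c‖ ^ n * ‖(kernelOp σ) ^ n‖ * ‖f‖ := by ring

end KernelAlgebra

/-! ### Densities of the powers of a twisted operator -/

section Densities

variable {X Y Z : Type*} [MeasurableSpace X] [MeasurableSpace Y] [MeasurableSpace Z]

/-- Duality of `L¹` and `L^∞`: the test function is the conjugate phase of `d` on `{K < ‖d‖}`. -/
lemma ae_norm_le_of_norm_integral_mul_le {μ : Measure Z} [IsFiniteMeasure μ] {d : Z → ℂ}
    (hd : Measurable d) {C K : ℝ} (hK : 0 ≤ K) (hdC : ∀ z, ‖d z‖ ≤ C)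
    (h : ∀ f : BddMeas Z, ‖∫ z, f z * d z ∂μ‖ ≤ K * ∫ z, ‖f z‖ ∂μ) : ∀ᵐ z ∂μ, ‖d z‖ ≤ K := by
  set A : Set Z := {z | K < ‖d z‖} with hA
  have hAm : MeasurableSet A := measurableSet_lt measurable_const hd.norm
  have hsgn : ∀ w : ℂ, ‖(starRingEnd ℂ) w / ‖w‖‖ ≤ 1 := fun w => by
    rw [norm_div, RCLike.norm_conj, Complex.norm_real, norm_norm]
    exact div_self_le_one _
  let f : BddMeas Z := BddMeas.mk (A.indicator fun z => (starRingEnd ℂ) (d z) / ‖d z‖)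
    (((Complex.continuous_conj.measurable.comp hd).div
      (Complex.measurable_ofReal.comp hd.norm)).indicator hAm) 1
    fun z => (norm_indicator_le_norm_self _ _).trans (hsgn _)
  have hfd : ∀ z, f z * d z = ((A.indicator (fun z => ‖d z‖) z : ℝ) : ℂ) := fun z => by
    by_cases hz : z ∈ A
    · simp only [f, BddMeas.mk_apply, Set.indicator_of_mem hz]
      rcases eq_or_ne (d z) 0 with h0 | h0
      · simp [h0]
      · have : (‖d z‖ : ℂ) ≠ 0 := by exact_mod_cast norm_ne_zero_iff.2 h0
        rw [div_mul_eq_mul_div, mul_comm, Complex.mul_conj, Complex.normSq_eq_norm_sq]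
        push_cast
        field_simp
    · simp [f, Set.indicator_of_notMem hz]
  have hfn : ∀ z, ‖f z‖ ≤ A.indicator 1 z := fun z => by
    by_cases hz : z ∈ A
    · simpa only [f, BddMeas.mk_apply, Set.indicator_of_mem hz, Pi.one_apply] using hsgn (d z)
    · simp [f, Set.indicator_of_notMem hz]
  have hint : IntegrableOn (fun z => ‖d z‖) A μ :=
    (Integrable.of_bound hd.norm.aestronglyMeasurable (C := C)
      (ae_of_all _ fun z => by simpa using hdC z)).integrableOn
  have h1 := h f
  simp only [hfd] at h1
  rw [integral_complex_ofReal, Complex.norm_real, integral_indicator hAm, Real.norm_eq_abs] at h1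
  have h2 : ∫ z, ‖f z‖ ∂μ ≤ μ.real A := by
    rw [← integral_indicator_one hAm]
    exact integral_mono (integrable_bddMeas μ f).norm ((integrable_const 1).indicator hAm) hfn
  have h3 : ∫ z in A, (‖d z‖ - K) ∂μ ≤ 0 := by
    rw [integral_sub hint (integrable_const K).integrableOn, setIntegral_const, sub_nonpos,
      smul_eq_mul, mul_comm]
    exact (le_abs_self _).trans (h1.trans (mul_le_mul_of_nonneg_left h2 hK))
  have hnn : 0 ≤ᵐ[μ.restrict A] fun z => ‖d z‖ - K :=
    (ae_restrict_iff' hAm).2 (ae_of_all _ fun z hz => sub_nonneg.2 (le_of_lt hz))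
  have h4 := (integral_eq_zero_iff_of_nonneg_ae hnn
    (hint.sub (integrable_const K).integrableOn)).1
    (le_antisymm h3 (integral_nonneg_of_ae hnn))
  filter_upwards [(ae_restrict_iff' hAm).1 h4] with z hz
  by_contra! hlt
  have := hz hlt
  simp only [Pi.zero_apply] at this
  linarith

lemma integrable_mul_comp (μ : Measure Y) [IsFiniteMeasure μ] {p : Y → Z} (hp : Measurable p)
    (f : BddMeas Z) {g : Y → ℂ} (hg : Measurable g) {K : ℝ} (hgK : ∀ y, ‖g y‖ ≤ K) :
    Integrable (fun y => f (p y) * g y) μ := by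
  refine Integrable.of_bound (C := ‖f‖ * K) ?_ (ae_of_all _ fun y => ?_)
  · exact ((f.measurable.comp hp).mul hg).aestronglyMeasurable
  · rw [norm_mul]
    exact mul_le_mul (f.norm_apply_le _) (hgK y) (norm_nonneg _) (norm_nonneg _)

variable [MeasurableSpace.CountableOrCountablyGenerated X Z]

/-- A jointly measurable version of the conditional expectation given `p` of a function with
values in `[0, 1]`. -/
lemma exists_condDensity_nnreal (Θ : Kernel X Y) [IsFiniteKernel Θ] {p : Y → Z} (hp : Measurable p)
    {g : X × Y → ℝ≥0} (hg : Measurable g) (hg1 : ∀ a, g a ≤ 1) :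
    ∃ d : X × Z → ℝ, Measurable d ∧ (∀ a, 0 ≤ d a ∧ d a ≤ 1) ∧ ∀ (f : BddMeas Z) (x : X),
      ∫ y, f (p y) * ((g (x, y) : ℝ) : ℂ) ∂(Θ x) = ∫ z, f z * (d (x, z) : ℂ) ∂((Θ x).map p) := by
  have hgm : Measurable (Function.uncurry fun x y => (g (x, y) : ℝ≥0∞)) := hg.coe_nnreal_ennreal
  have hfin : IsFiniteKernel (Kernel.withDensity Θ fun x y => (g (x, y) : ℝ≥0∞)) :=
    Kernel.isFiniteKernel_withDensity_of_bounded Θ ENNReal.one_ne_top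
      fun x y => by exact_mod_cast hg1 (x, y)
  -- The image of `g Θ` under `p` is dominated by that of `Θ`; the conditional expectation is the
  -- kernel Radon-Nikodym derivative, whose joint measurability relies on the countability
  -- assumption.
  set m : Kernel X Z := (Kernel.withDensity Θ fun x y => (g (x, y) : ℝ≥0∞)).map p with hm
  set θ : Kernel X Z := Θ.map p with hθ
  have hθx : ∀ x, θ x = (Θ x).map p := fun x => Kernel.map_apply _ hp x
  have hmx : ∀ x, m x = ((Θ x).withDensity fun y => (g (x, y) : ℝ≥0∞)).map p := fun x => by
    rw [hm, Kernel.map_apply _ hp, Kernel.withDensity_apply _ hgm]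
  have hle : ∀ x, m x ≤ θ x := fun x => by
    rw [hmx, hθx]
    refine Measure.map_mono ?_ hp
    calc (Θ x).withDensity (fun y => (g (x, y) : ℝ≥0∞)) ≤ (Θ x).withDensity 1 :=
          withDensity_mono (ae_of_all _ fun y => ENNReal.coe_le_one_iff.2 (hg1 (x, y)))
      _ = Θ x := withDensity_one
  have hae : ∀ x, ∀ᵐ z ∂(θ x), m.rnDeriv θ x z ≤ 1 := fun x => by
    filter_upwards [Kernel.rnDeriv_eq_rnDeriv_measure (κ := m) (η := θ) (a := x),
      Measure.rnDeriv_le_one_of_le (hle x)] with z h1 h2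
    rw [h1]
    exact h2
  refine ⟨fun a => (min (m.rnDeriv θ a.1 a.2) 1).toReal,
    ((m.measurable_rnDeriv θ).min measurable_const).ennreal_toReal,
    fun a => ⟨ENNReal.toReal_nonneg, ?_⟩, fun f x => ?_⟩
  · exact ENNReal.toReal_mono ENNReal.one_ne_top (min_le_right _ _)
  · have h1 : ∫ z, f z ∂(m x) = ∫ y, f (p y) * ((g (x, y) : ℝ) : ℂ) ∂(Θ x) := by
      rw [hmx, integral_map hp.aemeasurable f.measurable.aestronglyMeasurable,
        integral_withDensity_eq_integral_smul (f := fun y => g (x, y))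
          (hg.comp measurable_prodMk_left)]
      refine integral_congr_ae (ae_of_all _ fun y => ?_)
      simp [NNReal.smul_def, mul_comm]
    have h2 : ∫ z, f z ∂(m x)
        = ∫ z, f z * ((min (m.rnDeriv θ x z) 1).toReal : ℂ) ∂(θ x) := by
      have h3 : (θ x).withDensity (m.rnDeriv θ x) = m x := by
        rw [← Kernel.withDensity_apply _ (m.measurable_rnDeriv θ)]
        exact Kernel.withDensity_rnDeriv_eq (Measure.absolutelyContinuous_of_le (hle x))
      rw [← h3, integral_withDensity_eq_integral_toReal_smul (m.measurable_rnDeriv_right θ x)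
        (m.rnDeriv_lt_top θ)]
      refine integral_congr_ae ?_
      filter_upwards [hae x] with z hz
      simp only [min_eq_left hz, Complex.real_smul, mul_comm]
    rw [← h1, h2, hθx]

/-- Real and imaginary parts are treated separately, which loses the constant. The sharp bound `K`,
needed for `‖c‖ ≤ ‖χ‖ ^ n` later, is recovered by duality. -/
lemma exists_condDensity (Θ : Kernel X Y) [IsFiniteKernel Θ] {p : Y → Z} (hp : Measurable p)
    {h : X × Y → ℂ} (hh : Measurable h) {K : ℝ} (hK : 0 ≤ K) (hhK : ∀ a, ‖h a‖ ≤ K) :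
    ∃ d : BddMeas (X × Z), ‖d‖ ≤ K ∧ ∀ (f : BddMeas Z) (x : X),
      ∫ y, f (p y) * h (x, y) ∂(Θ x) = ∫ z, f z * d (x, z) ∂((Θ x).map p) := by
  have hpart : ∀ u : X × Y → ℝ, Measurable u → (∀ a, |u a| ≤ K) →
      ∃ d : X × Z → ℝ, Measurable d ∧ (∀ a, |d a| ≤ K + 1) ∧ ∀ (f : BddMeas Z) (x : X),
        ∫ y, f (p y) * (u (x, y) : ℂ) ∂(Θ x) = ∫ z, f z * (d (x, z) : ℂ) ∂((Θ x).map p) := by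
    intro u hu huK
    have hu1 : ∀ a, -K ≤ u a ∧ u a ≤ K := fun a => abs_le.1 (huK a)
    obtain ⟨d, hd, hd1, hdf⟩ := exists_condDensity_nnreal Θ hp
      -- An affine change of variable into `[0, 1]`; `K + 1` avoids division by zero when `K = 0`.
      (g := fun a => Real.toNNReal ((u a / (K + 1) + 1) / 2))
      (((hu.div_const _).add_const _).div_const _).real_toNNReal (fun a => by
        rw [Real.toNNReal_le_one, div_le_one two_pos, ← le_sub_iff_add_le,
          div_le_iff₀ (by positivity)]
        linarith [(hu1 a).2])
    refine ⟨fun a => (K + 1) * (2 * d a - 1), (((hd.const_mul _).sub_const _).const_mul _),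
      fun a => ?_, fun f x => ?_⟩
    · rw [abs_mul, abs_of_nonneg (by positivity : 0 ≤ K + 1)]
      refine mul_le_of_le_one_right (by positivity) (abs_le.2 ?_)
      constructor <;> linarith [(hd1 a).1, (hd1 a).2]
    · have hg : ∀ a, ((Real.toNNReal ((u a / (K + 1) + 1) / 2) : ℝ≥0) : ℝ)
          = (u a / (K + 1) + 1) / 2 := fun a => by
        refine Real.coe_toNNReal _ (div_nonneg ?_ two_pos.le)
        rw [← neg_le_iff_add_nonneg, le_div_iff₀ (by positivity)]
        linarith [(hu1 a).1]
      have h1 := hdf f x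
      simp only [hg] at h1
      have hK1 : ((K : ℂ) + 1) ≠ 0 := by exact_mod_cast (by positivity : K + 1 ≠ 0)
      have hi1 : Integrable (fun y => f (p y) * (((u (x, y) / (K + 1) + 1) / 2 : ℝ) : ℂ)) (Θ x) :=
        integrable_mul_comp _ hp f (by fun_prop) (K := 1) fun y => by
          rw [Complex.norm_real, Real.norm_eq_abs, ← hg, abs_of_nonneg NNReal.zero_le_coe, hg,
            div_le_one two_pos, ← le_sub_iff_add_le, div_le_iff₀ (by positivity)]
          linarith [(hu1 (x, y)).2]
      have hi2 : Integrable (fun y => f (p y)) (Θ x) := by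
        simpa using integrable_mul_comp (Θ x) hp f (g := fun _ => 1) measurable_const (K := 1)
          fun _ => by simp
      have hi3 : Integrable (fun z => f z * (d (x, z) : ℂ)) ((Θ x).map p) :=
        integrable_mul_comp _ measurable_id f (by fun_prop) (K := 1) fun z => by
          rw [Complex.norm_real, Real.norm_eq_abs, abs_of_nonneg (hd1 _).1]
          exact (hd1 _).2
      have e1 : ∫ y, f (p y) * (u (x, y) : ℂ) ∂(Θ x) = (K + 1) *
          (2 * (∫ y, f (p y) * (((u (x, y) / (K + 1) + 1) / 2 : ℝ) : ℂ) ∂(Θ x))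
            - ∫ y, f (p y) ∂(Θ x)) := by
        rw [← integral_const_mul, ← integral_sub (hi1.const_mul _) hi2, ← integral_const_mul]
        refine integral_congr_ae (ae_of_all _ fun y => ?_)
        push_cast
        field_simp
        ring
      have e2 : ∫ z, f z * (((K + 1) * (2 * d (x, z) - 1) : ℝ) : ℂ) ∂((Θ x).map p) = (K + 1) *
          (2 * (∫ z, f z * (d (x, z) : ℂ) ∂((Θ x).map p)) - ∫ z, f z ∂((Θ x).map p)) := by
        rw [← integral_const_mul, ← integral_sub (hi3.const_mul _) (integrable_bddMeas _ f),
          ← integral_const_mul]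
        refine integral_congr_ae (ae_of_all _ fun y => ?_)
        push_cast
        ring
      rw [e1, e2, h1, integral_map hp.aemeasurable f.measurable.aestronglyMeasurable]
  obtain ⟨d₁, hd₁, hd₁K, hd₁f⟩ := hpart (fun a => (h a).re) (Complex.measurable_re.comp hh)
    fun a => (Complex.abs_re_le_norm _).trans (hhK a)
  obtain ⟨d₂, hd₂, hd₂K, hd₂f⟩ := hpart (fun a => (h a).im) (Complex.measurable_im.comp hh)
    fun a => (Complex.abs_im_le_norm _).trans (hhK a)
  set d : X × Z → ℂ := fun a => d₁ a + d₂ a * Complex.I with hd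
  have hdm : Measurable d := by fun_prop
  have hdC : ∀ a, ‖d a‖ ≤ (K + 1) + (K + 1) := fun a => by
    refine (norm_add_le _ _).trans (add_le_add ?_ ?_)
    · rw [Complex.norm_real]
      exact hd₁K a
    · rw [norm_mul, Complex.norm_real, Complex.norm_I, mul_one]
      exact hd₂K a
  have hdf : ∀ (f : BddMeas Z) (x : X),
      ∫ y, f (p y) * h (x, y) ∂(Θ x) = ∫ z, f z * d (x, z) ∂((Θ x).map p) := fun f x => by
    have i1 : Integrable (fun y => f (p y) * (((h (x, y)).re : ℝ) : ℂ)) (Θ x) :=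
      integrable_mul_comp _ hp f (by fun_prop) (K := K) fun y => by
        rw [Complex.norm_real]
        exact (Complex.abs_re_le_norm _).trans (hhK _)
    have i2 : Integrable (fun y => f (p y) * (((h (x, y)).im : ℝ) : ℂ)) (Θ x) :=
      integrable_mul_comp _ hp f (by fun_prop) (K := K) fun y => by
        rw [Complex.norm_real]
        exact (Complex.abs_im_le_norm _).trans (hhK _)
    have i3 : Integrable (fun z => f z * (d₁ (x, z) : ℂ)) ((Θ x).map p) :=
      integrable_mul_comp _ measurable_id f (by fun_prop) (K := K + 1) fun y => by
        rw [Complex.norm_real]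
        exact hd₁K _
    have i4 : Integrable (fun z => f z * (d₂ (x, z) : ℂ)) ((Θ x).map p) :=
      integrable_mul_comp _ measurable_id f (by fun_prop) (K := K + 1) fun y => by
        rw [Complex.norm_real]
        exact hd₂K _
    have e1 : ∫ y, f (p y) * h (x, y) ∂(Θ x) = ∫ y, f (p y) * (((h (x, y)).re : ℝ) : ℂ) ∂(Θ x)
        + (∫ y, f (p y) * (((h (x, y)).im : ℝ) : ℂ) ∂(Θ x)) * Complex.I := by
      rw [← integral_mul_const, ← integral_add i1 (i2.mul_const _)]
      refine integral_congr_ae (ae_of_all _ fun y => ?_)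
      simp only
      rw [mul_assoc, ← mul_add, Complex.re_add_im]
    rw [e1, hd₁f, hd₂f, ← integral_mul_const, ← integral_add i3 (i4.mul_const _)]
    refine integral_congr_ae (ae_of_all _ fun y => ?_)
    simp only [hd]
    ring
  have hbound : ∀ x, ∀ᵐ z ∂((Θ x).map p), ‖d (x, z)‖ ≤ K := fun x => by
    refine ae_norm_le_of_norm_integral_mul_le (d := fun z => d (x, z))
      (hdm.comp measurable_prodMk_left) hK (fun z => hdC (x, z)) fun f => ?_
    rw [← hdf, integral_map hp.aemeasurable f.measurable.norm.aestronglyMeasurable,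
      ← integral_const_mul]
    refine norm_integral_le_of_norm_le ?_ (ae_of_all _ fun y => ?_)
    · have : Integrable (fun y => f (p y)) (Θ x) := by
        simpa using integrable_mul_comp (Θ x) hp f (g := fun _ => 1) measurable_const (K := 1)
          fun _ => by simp
      exact this.norm.const_mul K
    · rw [norm_mul, mul_comm]
      exact mul_le_mul_of_nonneg_right (hhK _) (norm_nonneg _)
  -- Setting `d` to zero off this set turns the almost sure bound into a bound everywhere.
  have hS : MeasurableSet {a | ‖d a‖ ≤ K} := measurableSet_le hdm.norm measurable_const
  refine ⟨BddMeas.mk ({a | ‖d a‖ ≤ K}.indicator d) (hdm.indicator hS) K fun a => ?_,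
    BddMeas.norm_le hK fun a => ?_, fun f x => ?_⟩
  · by_cases ha : ‖d a‖ ≤ K
    · rwa [Set.indicator_of_mem (show a ∈ {a | ‖d a‖ ≤ K} from ha)]
    · rwa [Set.indicator_of_notMem (show a ∉ {a | ‖d a‖ ≤ K} from ha), norm_zero]
  · by_cases ha : ‖d a‖ ≤ K
    · rwa [BddMeas.mk_apply, Set.indicator_of_mem (show a ∈ {a | ‖d a‖ ≤ K} from ha)]
    · rwa [BddMeas.mk_apply, Set.indicator_of_notMem (show a ∉ {a | ‖d a‖ ≤ K} from ha), norm_zero]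
  · rw [hdf]
    refine integral_congr_ae ?_
    filter_upwards [hbound x] with z hz
    exact congrArg (f z * ·) (Set.indicator_of_mem (show (x, z) ∈ {a | ‖d a‖ ≤ K} from hz) d).symm

end Densities

/-! ### Powers of a twisted operator as twisted operators of kernel powers. -/

section TwistedPow

variable {E : Type*} [MeasurableSpace E]

/-- For the two-step law `κ(x, dy) η(y, dz)`, the weight `d(x, z)` is the conditional expectation of
`c(x, y) χ(y, z)` given `z`. -/
lemma exists_twistedOp_mul_twistedOp [MeasurableSpace.CountableOrCountablyGenerated E E]
    (κ η : Kernel E E) [IsFiniteKernel κ] [IsFiniteKernel η] (c χ : BddMeas (E × E)) :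
    ∃ d : BddMeas (E × E), ‖d‖ ≤ ‖c‖ * ‖χ‖ ∧
      twistedOp κ c * twistedOp η χ = twistedOp (η ∘ₖ κ) d := by
  obtain ⟨d, hd, hdf⟩ := exists_condDensity (κ ⊗ₖ Kernel.prodMkLeft E η) measurable_snd
    (h := fun a : E × (E × E) => c (a.1, a.2.1) * χ a.2)
    ((c.measurable.comp (by fun_prop)).mul (χ.measurable.comp measurable_snd))
    (K := ‖c‖ * ‖χ‖) (by positivity) fun a => by
      rw [norm_mul]
      exact mul_le_mul (c.norm_apply_le _) (χ.norm_apply_le _) (norm_nonneg _) (norm_nonneg _)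
  refine ⟨d, hd, ?_⟩
  ext f x
  have h1 : ((κ ⊗ₖ Kernel.prodMkLeft E η) x).map Prod.snd = (η ∘ₖ κ) x := by
    rw [Kernel.comp_eq_snd_compProd, Kernel.snd_apply]
  have h2 := hdf f x
  rw [h1] at h2
  rw [twistedOp_apply, ← h2, integral_compProd]
  · rw [mul_apply_eq_comp, twistedOp_apply]
    refine integral_congr_ae (ae_of_all _ fun y => ?_)
    simp only [twistedOp_apply, Kernel.prodMkLeft_apply]
    rw [← integral_mul_const]
    refine integral_congr_ae (ae_of_all _ fun z => ?_)
    simp only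
    ring
  · refine integrable_mul_comp _ measurable_snd f (K := ‖c‖ * ‖χ‖) ?_ fun y => ?_
    · exact (c.measurable.comp (by fun_prop)).mul χ.measurable
    · rw [norm_mul]
      exact mul_le_mul (c.norm_apply_le _) (χ.norm_apply_le _) (norm_nonneg _) (norm_nonneg _)

lemma exists_twistedOp_pow [MeasurableSpace.CountableOrCountablyGenerated E E]
    (Q : Kernel E E) [IsFiniteKernel Q] (χ : BddMeas (E × E)) (n : ℕ) :
    ∃ c : BddMeas (E × E), ‖c‖ ≤ ‖χ‖ ^ n ∧ twistedOp Q χ ^ n = twistedOp (Q ^ n) c := by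
  induction n with
  | zero =>
    refine ⟨unitWeight E, by simpa using norm_unitWeight_le, ?_⟩
    rw [twistedOp_unitWeight, kernelOp_pow, pow_zero, pow_zero]
  | succ n ih =>
    obtain ⟨c, hc, hcn⟩ := ih
    obtain ⟨d, hd, hdn⟩ := exists_twistedOp_mul_twistedOp (Q ^ n) Q c χ
    refine ⟨d, hd.trans ?_, ?_⟩
    · rw [pow_succ]
      exact mul_le_mul_of_nonneg_right hc (norm_nonneg _)
    · rw [pow_succ, hcn, hdn]
      exact twistedOp_congr (pow_succ' Q n).symm d

end TwistedPow

/-! ### Sequential compactness -/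

section SeqCompact

lemma isCompactOperator_of_subseq {B : Type*} [NormedAddCommGroup B] [NormedSpace ℂ B]
    {W : B →L[ℂ] B} (hW : ∀ f : ℕ → B, (∀ n, ‖f n‖ ≤ 1) →
      ∃ φ : ℕ → ℕ, StrictMono φ ∧ ∃ g, Tendsto (fun n => W (f (φ n))) atTop (𝓝 g)) :
    IsCompactOperator W := by
  refine (isCompactOperator_iff_isCompact_closure_image_closedBall (W : B →ₗ[ℂ] B) one_pos).2 ?_
  rw [isCompact_iff_isSeqCompact]
  intro y hy
  have h1 : ∀ n : ℕ, ∃ f : B, ‖f‖ ≤ 1 ∧ dist (y n) (W f) < 1 / ((n : ℝ) + 1) := fun n => by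
    obtain ⟨_, ⟨f, hf, rfl⟩, hd⟩ := Metric.mem_closure_iff.1 (hy n) (1 / ((n : ℝ) + 1))
      (by positivity)
    exact ⟨f, by simpa using hf, hd⟩
  choose f hf hfd using h1
  obtain ⟨φ, hφ, g, hg⟩ := hW f hf
  have hlim : Tendsto (fun n => y (φ n)) atTop (𝓝 g) := by
    refine hg.congr_dist ?_
    refine squeeze_zero (fun _ => dist_nonneg) (fun n => ?_)
      ((tendsto_one_div_add_atTop_nhds_zero_nat (𝕜 := ℝ)).comp hφ.tendsto_atTop)
    rw [dist_comm]
    exact (hfd (φ n)).le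
  exact ⟨g, isClosed_closure.mem_of_tendsto hlim (Eventually.of_forall fun n => hy _), φ, hφ, hlim⟩

/-- Bounded sequences in a Hilbert space have weakly convergent subsequences. -/
lemma exists_subseq_tendsto_inner {H : Type*} [NormedAddCommGroup H] [InnerProductSpace ℂ H]
    [CompleteSpace H] (u : ℕ → H) {C : ℝ} (hu : ∀ n, ‖u n‖ ≤ C) :
    ∃ φ : ℕ → ℕ, StrictMono φ ∧ ∀ w : H, ∃ a : ℂ,
      Tendsto (fun n => inner ℂ (u (φ n)) w) atTop (𝓝 a) := by
  -- `H` need not be separable. On the closed span of the sequence, sequential Banach-Alaoglu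
  -- applies, and inner products with `w` see only its projection to `M`.
  set M : Submodule ℂ H := (Submodule.span ℂ (Set.range u)).topologicalClosure with hM
  have hMc : CompleteSpace M := (Submodule.isClosed_topologicalClosure _).completeSpace_coe
  have hMs : TopologicalSpace.SeparableSpace M := by
    have : TopologicalSpace.IsSeparable (M : Set H) :=
      ((Set.countable_range u).isSeparable.span (R := ℂ)).closure
    exact this.separableSpace
  have huM : ∀ n, u n ∈ M := fun n =>
    Submodule.le_topologicalClosure _ (Submodule.subset_span ⟨n, rfl⟩)
  let v : ℕ → WeakDual ℂ M := fun n =>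
    StrongDual.toWeakDual (InnerProductSpace.toDual ℂ M ⟨u n, huM n⟩)
  obtain ⟨ψ, -, φ, hφ, hlim⟩ := WeakDual.isSeqCompact_closedBall ℂ M 0 C (x := v) fun n => by
    change InnerProductSpace.toDual ℂ M ⟨u n, huM n⟩ ∈ Metric.closedBall 0 C
    rw [mem_closedBall_zero_iff, LinearIsometryEquiv.norm_map]
    exact hu n
  refine ⟨φ, hφ, fun w => ⟨ψ (M.orthogonalProjectionOnto w), ?_⟩⟩
  have h1 := (WeakDual.eval_continuous (M.orthogonalProjectionOnto w)).tendsto ψ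
  refine (h1.comp hlim).congr fun n => ?_
  change inner ℂ (⟨u (φ n), huM _⟩ : M) (M.orthogonalProjectionOnto w) = inner ℂ (u (φ n)) w
  rw [Submodule.coe_inner]
  have h2 : inner ℂ (u (φ n)) (w - M.orthogonalProjectionOnto w) = 0 :=
    M.sub_starProjection_mem_orthogonal w _ (huM _)
  rw [inner_sub_right, sub_eq_zero] at h2
  exact h2.symm

end SeqCompact

/-! ### Pointwise convergence of bounded sequences -/

section Pointwise

variable {E : Type*} [MeasurableSpace E]

/-- `V` maps bounded pointwise convergent sequences to pointwise convergent sequences. -/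
def PointwiseContinuous (V : BddMeas E →L[ℂ] BddMeas E) : Prop :=
  ∀ (f : ℕ → BddMeas E) (g : BddMeas E) (C : ℝ), (∀ n, ‖f n‖ ≤ C) →
    (∀ x, Tendsto (fun n => f n x) atTop (𝓝 (g x))) →
    ∀ x, Tendsto (fun n => V (f n) x) atTop (𝓝 (V g x))

lemma pointwiseContinuous_twistedOp (σ : Kernel E E) [IsFiniteKernel σ] (c : BddMeas (E × E)) :
    PointwiseContinuous (twistedOp σ c) := by
  intro f g C hf hfg x
  simp only [twistedOp_apply]
  refine tendsto_integral_of_dominated_convergence (fun _ => C * ‖c‖)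
    (fun n => (integrable_mul σ c (f n) x).aestronglyMeasurable) (integrable_const _)
    (fun n => ae_of_all _ fun y => ?_) (ae_of_all _ fun y => (hfg y).mul_const _)
  rw [norm_mul]
  exact mul_le_mul (((f n).norm_apply_le y).trans (hf n)) (c.norm_apply_le _) (norm_nonneg _)
    ((norm_nonneg _).trans (hf n))

lemma PointwiseContinuous.pow {V : BddMeas E →L[ℂ] BddMeas E} (hV : PointwiseContinuous V)
    (j : ℕ) : PointwiseContinuous (V ^ j) := by
  induction j with
  | zero => exact fun f g C _ hfg x => hfg x
  | succ j ih =>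
    intro f g C hf hfg x
    rw [pow_succ']
    exact hV (fun n => (V ^ j) (f n)) ((V ^ j) g) (‖V ^ j‖ * C)
      (fun n => ((V ^ j).le_opNorm _).trans (mul_le_mul_of_nonneg_left (hf n) (norm_nonneg _)))
      (ih f g C hf hfg) x

end Pointwise

/-! ### Operators with uniformly integrable densities -/

section Density

variable {E : Type*} [MeasurableSpace E] (ν : Measure E) (α : UnifIntDensity ν)

lemma measurable_density_section (x : E) : Measurable fun y => α.1 (x, y) :=
  α.2.1.comp measurable_prodMk_left

/-- The set where the density exceeds `m`. -/
def largeSet (m : ℝ≥0) (x : E) : Set E := {y | m ≤ α.1 (x, y)}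

lemma measurableSet_largeSet (m : ℝ≥0) (x : E) : MeasurableSet (largeSet ν α m x) :=
  measurableSet_le measurable_const (measurable_density_section ν α x)

lemma norm_indicator_density_le (m : ℝ≥0) (x y : E) :
    ‖(largeSet ν α m x)ᶜ.indicator (fun y => ((α.1 (x, y) : ℝ) : ℂ)) y‖ ≤ m := by
  by_cases hy : y ∈ (largeSet ν α m x)ᶜ
  · rw [Set.indicator_of_mem hy, Complex.norm_real, Real.norm_eq_abs,
      abs_of_nonneg NNReal.zero_le_coe]
    have : α.1 (x, y) < m := not_le.1 hy
    exact_mod_cast this.le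
  · rw [Set.indicator_of_notMem hy, norm_zero]
    exact NNReal.zero_le_coe

lemma measurable_indicator_density (m : ℝ≥0) (x : E) :
    Measurable ((largeSet ν α m x)ᶜ.indicator (fun y => ((α.1 (x, y) : ℝ) : ℂ))) :=
  (Complex.measurable_ofReal.comp (measurable_density_section ν α x).coe_nnreal_real).indicator
    (measurableSet_largeSet ν α m x).compl

variable [IsProbabilityMeasure ν]

lemma densityKernel_eq_withDensity (x : E) :
    densityKernel ν α x = ν.withDensity fun y => (α.1 (x, y) : ℝ≥0∞) := by
  ext s hs
  rw [densityKernel_apply, withDensity_apply _ hs]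

lemma exists_measureReal_largeSet_le {ε : ℝ} (hε : 0 < ε) :
    ∃ m : ℝ≥0, ∀ x, (densityKernel ν α x).real (largeSet ν α m x) ≤ ε := by
  obtain ⟨m, hm⟩ := (α.2.2.eventually (gt_mem_nhds (ENNReal.ofReal_pos.2 hε))).exists
  refine ⟨m, fun x => ENNReal.toReal_le_of_le_ofReal hε.le ?_⟩
  rw [densityKernel_apply]
  exact (le_iSup (fun x : E => ∫⁻ y in {y | m ≤ α.1 (x, y)}, (α.1 (x, y) : ℝ≥0∞) ∂ν) x).trans hm.le

lemma setIntegral_compl_largeSet (m : ℝ≥0) (x : E) (g : E → ℂ) :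
    ∫ y in (largeSet ν α m x)ᶜ, g y ∂(densityKernel ν α x)
      = ∫ y, g y * ((largeSet ν α m x)ᶜ.indicator (fun y => ((α.1 (x, y) : ℝ) : ℂ)) y) ∂ν := by
  rw [densityKernel_eq_withDensity, setIntegral_withDensity_eq_setIntegral_smul
    (measurable_density_section ν α x) _ (measurableSet_largeSet ν α m x).compl,
    ← integral_indicator (measurableSet_largeSet ν α m x).compl]
  refine integral_congr_ae (ae_of_all _ fun y => ?_)
  by_cases hy : y ∈ (largeSet ν α m x)ᶜ
  · simp only [Set.indicator_of_mem hy, NNReal.smul_def, Complex.real_smul, mul_comm]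
  · simp only [Set.indicator_of_notMem hy, mul_zero]

/-- Up to a small error, the operator with density `α` is given by a bounded density. -/
lemma exists_norm_twistedOp_sub_le (c : BddMeas (E × E)) {ε : ℝ} (hε : 0 < ε) :
    ∃ m : ℝ≥0, ∀ (f : BddMeas E) (x : E),
      ‖twistedOp (densityKernel ν α) c f x - ∫ y, f y * c (x, y) *
        ((largeSet ν α m x)ᶜ.indicator (fun y => ((α.1 (x, y) : ℝ) : ℂ)) y) ∂ν‖ ≤ ε * ‖f‖ := by
  obtain ⟨m, hm⟩ := exists_measureReal_largeSet_le ν α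
    (div_pos hε (by positivity : 0 < ‖c‖ + 1))
  refine ⟨m, fun f x => ?_⟩
  rw [twistedOp_apply, ← setIntegral_compl_largeSet ν α m x (fun y => f y * c (x, y)),
    ← integral_add_compl (measurableSet_largeSet ν α m x) (integrable_mul _ c f x),
    add_sub_cancel_right]
  refine (norm_setIntegral_le_of_norm_le_const (C := ‖f‖ * (‖c‖ + 1))
    (measure_lt_top _ _) fun y _ => ?_).trans ?_
  · rw [norm_mul]
    exact mul_le_mul (f.norm_apply_le y) ((c.norm_apply_le _).trans (by linarith))
      (norm_nonneg _) (norm_nonneg _)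
  · calc ‖f‖ * (‖c‖ + 1) * (densityKernel ν α x).real (largeSet ν α m x)
        ≤ ‖f‖ * (‖c‖ + 1) * (ε / (‖c‖ + 1)) := by
          refine mul_le_mul_of_nonneg_left (hm x) (by positivity)
      _ = ε * ‖f‖ := by field_simp

/-- The operator maps bounded pointwise convergent sequences to norm convergent sequences. -/
lemma tendsto_twistedOp_densityKernel (c : BddMeas (E × E)) {f : ℕ → BddMeas E} {g : BddMeas E}
    {C : ℝ} (hf : ∀ n, ‖f n‖ ≤ C) (hfg : ∀ x, Tendsto (fun n => f n x) atTop (𝓝 (g x))) :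
    Tendsto (fun n => twistedOp (densityKernel ν α) c (f n)) atTop
      (𝓝 (twistedOp (densityKernel ν α) c g)) := by
  have hC : 0 ≤ C := (norm_nonneg _).trans (hf 0)
  set C' : ℝ := C + ‖g‖ + 1 with hC'
  have hC'0 : 0 < C' := by positivity
  have hdiff : ∀ n, ‖f n - g‖ ≤ C' := fun n =>
    (norm_sub_le _ _).trans (by linarith [hf n])
  have hL1 : Tendsto (fun n => ∫ y, ‖(f n - g) y‖ ∂ν) atTop (𝓝 0) := by
    have := tendsto_integral_of_dominated_convergence (μ := ν)
      (F := fun n y => ‖(f n - g) y‖) (f := fun _ => 0) (fun _ => C')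
      (fun n => (f n - g).measurable.norm.aestronglyMeasurable) (integrable_const _)
      (fun n => ae_of_all _ fun y => by
        rw [norm_norm]
        exact ((f n - g).norm_apply_le y).trans (hdiff n))
      (ae_of_all _ fun y => tendsto_iff_norm_sub_tendsto_zero.1 (hfg y))
    simpa using this
  rw [Metric.tendsto_atTop]
  intro ε hε
  -- The truncation level is uniform in `x`, and the truncated part is at most `‖c‖ m` times the
  -- `L¹(ν)` norm of `f n - g`; hence convergence in supremum norm.
  obtain ⟨m, hm⟩ := exists_norm_twistedOp_sub_le ν α c (ε := ε / (4 * C')) (by positivity)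
  obtain ⟨N, hN⟩ := Metric.tendsto_atTop.1 (hL1.const_mul (‖c‖ * m)) (ε / 4) (by positivity)
  refine ⟨N, fun n hn => ?_⟩
  have h1 := hN n hn
  rw [mul_zero, dist_zero_right, Real.norm_eq_abs] at h1
  rw [dist_eq_norm, ← map_sub]
  refine lt_of_le_of_lt (BddMeas.norm_le (C := ε / 2) (by positivity) fun x => ?_) (by linarith)
  have h2 := hm (f n - g) x
  have h3 : ‖∫ y, (f n - g) y * c (x, y) *
      ((largeSet ν α m x)ᶜ.indicator (fun y => ((α.1 (x, y) : ℝ) : ℂ)) y) ∂ν‖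
      ≤ (‖c‖ * m) * ∫ y, ‖(f n - g) y‖ ∂ν := by
    rw [← integral_const_mul]
    refine norm_integral_le_of_norm_le ((integrable_bddMeas ν _).norm.const_mul _)
      (ae_of_all _ fun y => ?_)
    rw [norm_mul, norm_mul]
    calc ‖(f n - g) y‖ * ‖c (x, y)‖ * _ ≤ ‖(f n - g) y‖ * ‖c‖ * m :=
          mul_le_mul (mul_le_mul_of_nonneg_left (c.norm_apply_le _) (norm_nonneg _))
            (norm_indicator_density_le ν α m x y) (norm_nonneg _) (by positivity)
      _ = ‖c‖ * m * ‖(f n - g) y‖ := by ring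
  have h4 : ε / (4 * C') * ‖f n - g‖ ≤ ε / 4 := by
    calc ε / (4 * C') * ‖f n - g‖ ≤ ε / (4 * C') * C' :=
          mul_le_mul_of_nonneg_left (hdiff n) (by positivity)
      _ = ε / 4 := by field_simp
  have h5 := norm_le_norm_sub_add (twistedOp (densityKernel ν α) c (f n - g) x)
    (∫ y, (f n - g) y * c (x, y) *
      ((largeSet ν α m x)ᶜ.indicator (fun y => ((α.1 (x, y) : ℝ) : ℂ)) y) ∂ν)
  linarith [(abs_lt.1 h1).2]

lemma memLp_bddMeas (f : BddMeas E) : MemLp (fun y => f y) 2 ν :=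
  MemLp.of_bound f.measurable.aestronglyMeasurable ‖f‖ (ae_of_all _ f.norm_apply_le)

/-- Bounded sequences have subsequences along which all integrals against bounded densities
converge. -/
lemma exists_subseq_tendsto_integral (f : ℕ → BddMeas E) {C : ℝ} (hf : ∀ n, ‖f n‖ ≤ C) :
    ∃ φ : ℕ → ℕ, StrictMono φ ∧ ∀ (h : BddMeas E), ∃ a : ℂ,
      Tendsto (fun n => ∫ y, f (φ n) y * h y ∂ν) atTop (𝓝 a) := by
  have hC : 0 ≤ C := (norm_nonneg _).trans (hf 0)
  obtain ⟨φ, hφ, hlim⟩ := exists_subseq_tendsto_inner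
    (fun n => (memLp_bddMeas ν (f n)).toLp (fun y => f n y)) fun n =>
      Lp.norm_le_of_ae_bound hC (by
        filter_upwards [(memLp_bddMeas ν (f n)).coeFn_toLp] with y hy
        rw [hy]
        exact ((f n).norm_apply_le y).trans (hf n))
  refine ⟨φ, hφ, fun h => ?_⟩
  -- The inner product is conjugate linear in its first slot, so `h` is conjugated before and the
  -- limit after.
  let k : BddMeas E := BddMeas.mk (fun y => (starRingEnd ℂ) (h y))
    (Complex.continuous_conj.measurable.comp h.measurable) ‖h‖ fun y => by
      rw [RCLike.norm_conj]
      exact h.norm_apply_le y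
  obtain ⟨a, ha⟩ := hlim ((memLp_bddMeas ν k).toLp _)
  refine ⟨(starRingEnd ℂ) a, ((Complex.continuous_conj.tendsto a).comp ha).congr fun n => ?_⟩
  rw [Function.comp_apply, L2.inner_def, ← integral_conj]
  refine integral_congr_ae ?_
  filter_upwards [(memLp_bddMeas ν (f (φ n))).coeFn_toLp, (memLp_bddMeas ν k).coeFn_toLp]
    with y h1 h2
  rw [h1, h2, RCLike.inner_apply, map_mul, RCLike.conj_conj, mul_comm]
  exact congrArg (f (φ n) y * ·) (RCLike.conj_conj (h y))

/-- The image of a bounded sequence under the operator has a pointwise convergent subsequence. -/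
lemma exists_subseq_tendsto_twistedOp (c : BddMeas (E × E)) (f : ℕ → BddMeas E) {C : ℝ}
    (hf : ∀ n, ‖f n‖ ≤ C) : ∃ φ : ℕ → ℕ, StrictMono φ ∧ ∃ g : BddMeas E, ∀ x,
      Tendsto (fun n => twistedOp (densityKernel ν α) c (f (φ n)) x) atTop (𝓝 (g x)) := by
  have hC : 0 ≤ C := (norm_nonneg _).trans (hf 0)
  obtain ⟨φ, hφ, hlim⟩ := exists_subseq_tendsto_integral ν f hf
  set A := twistedOp (densityKernel ν α) c with hA
  -- The test function `h` below depends on `x`, but the single subsequence `φ` serves all bounded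
  -- `h`, hence all `x` at once.
  have hcauchy : ∀ x, CauchySeq fun n => A (f (φ n)) x := by
    intro x
    rw [Metric.cauchySeq_iff']
    intro ε hε
    obtain ⟨m, hm⟩ := exists_norm_twistedOp_sub_le ν α c (ε := ε / (4 * (C + 1))) (by positivity)
    let h : BddMeas E := BddMeas.mk
      (fun y => c (x, y) * (largeSet ν α m x)ᶜ.indicator (fun y => ((α.1 (x, y) : ℝ) : ℂ)) y)
      ((c.measurable.comp measurable_prodMk_left).mul (measurable_indicator_density ν α m x))
      (‖c‖ * m) fun y => by
        rw [norm_mul]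
        exact mul_le_mul (c.norm_apply_le _) (norm_indicator_density_le ν α m x y)
          (norm_nonneg _) (norm_nonneg _)
    obtain ⟨a, ha⟩ := hlim h
    obtain ⟨N, hN⟩ := Metric.cauchySeq_iff'.1 ha.cauchySeq (ε / 2) (by positivity)
    refine ⟨N, fun n hn => ?_⟩
    have key : ∀ k, ‖A (f (φ k)) x - ∫ y, f (φ k) y * h y ∂ν‖ < ε / 4 := fun k => by
      have h1 := hm (f (φ k)) x
      simp only [mul_assoc] at h1
      refine lt_of_le_of_lt h1 ?_
      calc ε / (4 * (C + 1)) * ‖f (φ k)‖ ≤ ε / (4 * (C + 1)) * C :=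
            mul_le_mul_of_nonneg_left (hf _) (by positivity)
        _ < ε / (4 * (C + 1)) * (C + 1) := mul_lt_mul_of_pos_left (by linarith) (by positivity)
        _ = ε / 4 := by field_simp
    have h1 := key n
    have h2 := key N
    have h3 := hN n hn
    rw [← dist_eq_norm] at h1 h2
    calc dist (A (f (φ n)) x) (A (f (φ N)) x)
        ≤ dist (A (f (φ n)) x) (∫ y, f (φ n) y * h y ∂ν)
          + dist (∫ y, f (φ n) y * h y ∂ν) (∫ y, f (φ N) y * h y ∂ν)
          + dist (∫ y, f (φ N) y * h y ∂ν) (A (f (φ N)) x) := dist_triangle4 _ _ _ _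
      _ < ε := by
        rw [dist_comm _ (A (f (φ N)) x)]
        linarith
  choose g hg using fun x => cauchySeq_tendsto_of_complete (hcauchy x)
  refine ⟨φ, hφ, BddMeas.mk g (measurable_of_tendsto_metrizable
    (fun n => (A (f (φ n))).measurable) (tendsto_pi_nhds.2 hg)) (‖A‖ * C) fun x => ?_, hg⟩
  refine le_of_tendsto (hg x).norm (Eventually.of_forall fun n => ?_)
  refine (BddMeas.norm_apply_le _ x).trans ((A.le_opNorm _).trans ?_)
  exact mul_le_mul_of_nonneg_left (hf _) (norm_nonneg _)

/-- The right factor extracts pointwise convergence, `V` keeps it, and the left factor upgrades it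
to norm convergence. -/
theorem isCompactOperator_twistedOp_mul_mul (c : BddMeas (E × E)) {V : BddMeas E →L[ℂ] BddMeas E}
    (hV : PointwiseContinuous V) :
    IsCompactOperator (twistedOp (densityKernel ν α) c * V * twistedOp (densityKernel ν α) c :
      BddMeas E →L[ℂ] BddMeas E) := by
  refine isCompactOperator_of_subseq fun f hf => ?_
  obtain ⟨φ, hφ, g, hg⟩ := exists_subseq_tendsto_twistedOp ν α c f hf
  set A := twistedOp (densityKernel ν α) c with hA
  have hAf : ∀ n, ‖A (f (φ n))‖ ≤ ‖A‖ * 1 := fun n =>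
    (A.le_opNorm _).trans (mul_le_mul_of_nonneg_left (hf _) (norm_nonneg _))
  exact ⟨φ, hφ, A (V g), tendsto_twistedOp_densityKernel ν α c
    (fun n => (V.le_opNorm _).trans (mul_le_mul_of_nonneg_left (hAf n) (norm_nonneg _)))
    (hV _ g _ hAf hg)⟩

end Density

/-! ### Quasi-compactness -/

section Main

variable {E : Type*} [MeasurableSpace E]

/-- If `U ^ l` is the operator of `Q ^ l` weighted by a bounded function, then the essential
spectral radius of `U` is controlled by the spectral radius of `S = Q ^ l - T`. -/
theorem essSpectralRadius_le (Q : Kernel E E) [IsFiniteKernel Q] {l : ℕ} (hl : l ≠ 0)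
    (ν : Measure E) [IsProbabilityMeasure ν] (α : UnifIntDensity ν)
    (hpos : ∀ x, densityKernel ν α x ≤ (Q ^ l) x) {S : BddMeas E →L[ℂ] BddMeas E}
    (hS : S = kernelOp Q ^ l - kernelOp (densityKernel ν α)) {U : BddMeas E →L[ℂ] BddMeas E}
    {c : BddMeas (E × E)} (hU : U ^ l = twistedOp (Q ^ l) c) {K : ℝ≥0} (hc : ‖c‖ ≤ (K : ℝ) ^ l) :
    essSpectralRadius U ≤ K * spectralRadius ℂ S ^ (1 / (l : ℝ)) := by
  have hl0 : (l : ℝ) ≠ 0 := by exact_mod_cast hl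
  have hl' : (0 : ℝ) < l := by exact_mod_cast Nat.pos_of_ne_zero hl
  refine le_of_forall_gt_imp_ge_of_dense fun ρ' hρ' => ?_
  rcases eq_or_ne ρ' ∞ with rfl | htop
  · exact le_top
  lift ρ' to ℝ≥0 using htop with ρ
  refine sInf_le (Set.mem_insert_of_mem _ ⟨ρ, ?_, rfl⟩)
  have hρ : 0 < ρ := by
    have : (0 : ℝ≥0∞) < ρ := (zero_le).trans_lt hρ'
    exact_mod_cast this
  have hSσ : S = kernelOp (subKernel (Q ^ l) (densityKernel ν α) hpos) := by
    rw [hS, kernelOp_subKernel, kernelOp_pow]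
  have hlt : (K : ℝ≥0∞) ^ l * spectralRadius ℂ S < (ρ : ℝ≥0∞) ^ l := by
    have h1 := ENNReal.rpow_lt_rpow hρ' hl'
    rwa [ENNReal.mul_rpow_of_nonneg _ _ hl'.le, ← ENNReal.rpow_mul, one_div,
      inv_mul_cancel₀ hl0, ENNReal.rpow_one, ENNReal.rpow_natCast, ENNReal.rpow_natCast] at h1
  obtain ⟨b, hb, hbρ⟩ : ∃ b : ℝ≥0, spectralRadius ℂ S < b ∧ K ^ l * b < ρ ^ l := by
    have hfin : spectralRadius ℂ S ≠ ∞ := by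
      refine ne_top_of_le_ne_top ?_ (spectrum.spectralRadius_le_pow_nnnorm_pow_one_div ℂ S 0)
      finiteness
    lift spectralRadius ℂ S to ℝ≥0 using hfin with s
    have hs : K ^ l * s < ρ ^ l := by exact_mod_cast hlt
    have hcont : ContinuousAt (fun b : ℝ≥0 => K ^ l * b) s := by fun_prop
    obtain ⟨b, hb, hsb⟩ := (((hcont.eventually (gt_mem_nhds hs)).filter_mono
      (nhdsWithin_le_nhds (s := Set.Ioi s))).and self_mem_nhdsWithin).exists
    exact ⟨b, by exact_mod_cast hsb, hb⟩
  obtain ⟨C, hC, hSC⟩ := exists_norm_pow_le_of_spectralRadius_lt hb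
  -- Strictness makes `a` positive even when `K = 0`.
  obtain ⟨a, hab, haρ⟩ := exists_between hbρ
  refine splitsAt_of_pow_eq_add_of_compact hl hρ
    (hU.trans (twistedOp_subKernel (Q ^ l) (densityKernel ν α) hpos c))
    (fun j => isCompactOperator_twistedOp_mul_mul ν α c
      ((pointwiseContinuous_twistedOp _ c).pow j)) hC (a := a)
    (NNReal.coe_pos.2 (pos_of_gt hab)) (by exact_mod_cast haρ) fun n => ?_
  have hKb : (K : ℝ) ^ l * b ≤ a := by exact_mod_cast hab.le
  refine (norm_twistedOp_pow_le _ c n).trans ?_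
  rw [← hSσ]
  calc ‖c‖ ^ n * ‖S ^ n‖ ≤ ((K : ℝ) ^ l) ^ n * (C * (b : ℝ) ^ n) :=
        mul_le_mul (pow_le_pow_left₀ (norm_nonneg _) hc n) (hSC n) (norm_nonneg _) (by positivity)
    _ = C * ((K : ℝ) ^ l * b) ^ n := by ring
    _ ≤ C * (a : ℝ) ^ n :=
        mul_le_mul_of_nonneg_left (pow_le_pow_left₀ (by positivity) hKb n) hC

end Main

end KernelQC

theorem mainTheorem1 {E : Type*} [MeasurableSpace E]
    (Q : ProbabilityTheory.Kernel E E) [ProbabilityTheory.IsFiniteKernel Q]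
    (l : ℕ) (hl : 1 ≤ l)
    (ν : MeasureTheory.Measure E) [MeasureTheory.IsProbabilityMeasure ν]
    (α : KernelQC.UnifIntDensity ν)
    (hpos : ∀ (x : E) (A : Set E), MeasurableSet A →
      KernelQC.densityKernel ν α x A ≤ (Q ^ l) x A)
    (S : KernelQC.BddMeas E →L[ℂ] KernelQC.BddMeas E)
    (hS : S = KernelQC.kernelOp Q ^ l - KernelQC.kernelOp (KernelQC.densityKernel ν α))
    (hr : spectralRadius ℂ S ^ (1 / (l : ℝ)) < spectralRadius ℂ (KernelQC.kernelOp Q)) :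
    (KernelQC.IsQuasiCompact (KernelQC.kernelOp Q) ∧
      KernelQC.essSpectralRadius (KernelQC.kernelOp Q) ≤ spectralRadius ℂ S ^ (1 / (l : ℝ))) ∧
    ((l = 1 ∨ MeasurableSpace.CountablyGenerated E) →
      ∀ χ : KernelQC.BddMeas (E × E),
        ‖χ‖ₑ * spectralRadius ℂ S ^ (1 / (l : ℝ)) < spectralRadius ℂ (KernelQC.twistedOp Q χ) →
        KernelQC.IsQuasiCompact (KernelQC.twistedOp Q χ) ∧
          KernelQC.essSpectralRadius (KernelQC.twistedOp Q χ) ≤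
            ‖χ‖ₑ * spectralRadius ℂ S ^ (1 / (l : ℝ))) := by
  have hl0 : l ≠ 0 := by omega
  have hle : ∀ x, KernelQC.densityKernel ν α x ≤ (Q ^ l) x := fun x =>
    Measure.le_iff.2 (hpos x)
  refine ⟨?_, fun hcg χ hχ => ?_⟩
  · have h : KernelQC.essSpectralRadius (KernelQC.kernelOp Q)
        ≤ spectralRadius ℂ S ^ (1 / (l : ℝ)) := by
      have := KernelQC.essSpectralRadius_le Q hl0 ν α hle hS (U := KernelQC.kernelOp Q)
        (c := KernelQC.unitWeight E) (K := 1)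
        (by rw [KernelQC.twistedOp_unitWeight, KernelQC.kernelOp_pow])
        (by simpa using KernelQC.norm_unitWeight_le)
      simpa using this
    exact ⟨h.trans_lt hr, h⟩
  · obtain ⟨c, hc, hcl⟩ : ∃ c : KernelQC.BddMeas (E × E), ‖c‖ ≤ ‖χ‖ ^ l ∧
        KernelQC.twistedOp Q χ ^ l = KernelQC.twistedOp (Q ^ l) c := by
      -- For `l = 1` the weight is `χ` itself, so no conditional expectation is needed.
      rcases hcg with rfl | hcg
      · refine ⟨χ, by rw [pow_one], ?_⟩
        rw [pow_one]
        exact KernelQC.twistedOp_congr (pow_one Q).symm χ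
      · exact KernelQC.exists_twistedOp_pow Q χ l
    have h := KernelQC.essSpectralRadius_le Q hl0 ν α hle hS (U := KernelQC.twistedOp Q χ)
      (c := c) (K := ‖χ‖₊) hcl hc
    exact ⟨h.trans_lt hχ, h⟩
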